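/- **Theorem 5.2 (convexity principle).** Let $d\ge 1$ and $\mathbb{R}^d_+=(0,\infty)^d$. For $\alpha\in(-1,\infty)^d$ put $|\alpha|=\alpha_1+\dots+\alpha_d$ and $d\mu_\alpha(x)=\prod_{i=1}^d x_i^{2\alpha_i+1}\,dx$ on $\mathbb{R}^d_+$, and for $k\in\mathbb{N}^d$ let $$\ell_k^\alpha(x)=\prod_{i=1}^d\Big(\frac{2\,\Gamma(k_i+1)}{\Gamma(k_i+\alpha_i+1)}\Big)^{1/2}L_{k_i}^{\alpha_i}(x_i^2)\,e^{-x_i^2/2},\qquad x\in\mathbb{R}^d_+,$$ where $L_n^{a}$ is the Laguerre polynomial of degree $n$ and order $a$. For $\sigma>0$ define $$G_t^\alpha(x,y)=\sum_{n=0}^\infty e^{-t(4n+2|\alpha|+2d)}\sum_{|k|=n}\ell_k^\alpha(x)\ell_k^\alpha(y),\qquad \mathcal{K}^{\alpha,\sigma}(x,y)=\frac1{\Gamma(\sigma)}\int_0^\infty G_t^\alpha(x,y)\,t^{\sigma-1}\,dt,$$ $$\mathcal{I}^{\alpha,\sigma}f(x)=\int_{\mathbb{R}^d_+}\mathcal{K}^{\alpha,\sigma}(x,y)f(y)\,d\mu_\alpha(y),\qquad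 x\in\mathbb{R}^d_+ .$$ For $1\le p,q<\infty$ and weights $U,V$ on $\mathbb{R}^d_+$ we say that $\mathcal{I}^{\alpha,\sigma}\colon L^p(U\,d\mu_\alpha)\to L^q(V\,d\mu_\alpha)$ is bounded if there is a constant $C<\infty$ such that for every $f\in L^p(U\,d\mu_\alpha)$ the integral defining $\mathcal{I}^{\alpha,\sigma}f(x)$ converges (absolutely) for almost every $x\in\mathbb{R}^d_+$, $\mathcal{I}^{\alpha,\sigma}f\in L^q(V\,d\mu_\alpha)$, and $\|\mathcal{I}^{\alpha,\sigma}f\|_{L^q(V d\mu_\alpha)}\le C\|f\|_{L^p(U d\mu_\alpha)}$. Let $\beta,\gamma\in(-1,\infty)^d$ with $\beta\ne\gamma$, $\sigma_1,\sigma_2>0$, $1\le p,q<\infty$, and let $U_1,U_2,V_1,V_2$ be (measurable) weights on $\mathbb{R}^d_+$ that are strictly positive up to a set of null measure. For a fixed $\lambda\in(0,1)$ put $$\alpha=\lambda\beta+(1-\lambda)\gamma,\quad \sigma=\lambda\sigma_1+(1-\lambda)\sigma_2,\quad U=U_1^\lambda U_2^{1-\lambda},\quad V=V_1^\lambda V_2^{1-\lambda}.$$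 If the operators $$\mathcal{I}^{\beta,\sigma_1}\colon L^p(U_1d\mu_\beta)\to L^q(V_1d\mu_\beta)\quad\text{and}\quad \mathcal{I}^{\gamma,\sigma_2}\colon L^p(U_2d\mu_\gamma)\to L^q(V_2d\mu_\gamma)$$ are bounded, then the operator $$\mathcal{I}^{\alpha,\sigma}\colon L^p(Ud\mu_\alpha)\to L^q(Vd\mu_\alpha)$$ is bounded. -/

import Mathlib

open MeasureTheory
open scoped ENNReal NNReal

noncomputable section

namespace LaguerreConv

/-- The open orthant `(0,∞)^d`. -/
def orthant (d : ℕ) : Set (Fin d → ℝ) := {x | ∀ i, 0 < x i}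

/-- Lebesgue measure on the orthant `(0,∞)^d`. -/
def orthantVolume (d : ℕ) : Measure (Fin d → ℝ) := volume.restrict (orthant d)

/-- The measure `μ_α(dx) = x₁^(2α₁+1) ⋯ x_d^(2α_d+1) dx` on `(0,∞)^d`. -/
def mu {d : ℕ} (α : Fin d → ℝ) : Measure (Fin d → ℝ) :=
  (orthantVolume d).withDensity fun x => ENNReal.ofReal (∏ i, x i ^ (2 * α i + 1))

/-- The measure `w dμ_α` for a weight `w`. -/
def weightedMu {d : ℕ} (w : (Fin d → ℝ) → ℝ) (α : Fin d → ℝ) : Measure (Fin d → ℝ) :=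
  (mu α).withDensity fun x => ENNReal.ofReal (w x)

/-- The Laguerre polynomial of degree `n` and order `a > -1`,
`L_n^a(u) = ∑_{j ≤ n} Γ(n+a+1) / (Γ(j+a+1) (n-j)!) * (-u)^j / j!`. -/
def laguerrePoly (n : ℕ) (a u : ℝ) : ℝ :=
  ∑ j ∈ Finset.range (n + 1),
    Real.Gamma (n + a + 1) / (Real.Gamma (j + a + 1) * ((n - j).factorial : ℝ)) *
      ((-u) ^ j / (j.factorial : ℝ))

/-- The one-dimensional Laguerre function
`ℓ_n^a(u) = (2 Γ(n+1) / Γ(n+a+1))^(1/2) L_n^a(u²) exp(-u²/2)`. -/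
def laguerreFun₁ (n : ℕ) (a u : ℝ) : ℝ :=
  Real.sqrt (2 * Real.Gamma (n + 1) / Real.Gamma (n + a + 1)) *
    laguerrePoly n a (u ^ 2) * Real.exp (-(u ^ 2) / 2)

/-- The Laguerre function `ℓ_k^α(x) = ∏ i, ℓ_{k_i}^{α_i}(x_i)`. -/
def laguerreFun {d : ℕ} (k : Fin d → ℕ) (α x : Fin d → ℝ) : ℝ :=
  ∏ i, laguerreFun₁ (k i) (α i) (x i)

/-- The heat kernel
`G_t^α(x,y) = ∑_n exp(-t(4n+2|α|+2d)) ∑_{|k|=n} ℓ_k^α(x) ℓ_k^α(y)`, where `|α| = ∑ i, α i`. -/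
def heatKernel {d : ℕ} (α : Fin d → ℝ) (t : ℝ) (x y : Fin d → ℝ) : ℝ :=
  ∑' n : ℕ, Real.exp (-t * (4 * n + 2 * (∑ i, α i) + 2 * d)) *
    ∑ k ∈ Finset.piAntidiag (Finset.univ : Finset (Fin d)) n,
      laguerreFun k α x * laguerreFun k α y

/-- The potential kernel `K^{α,σ}(x,y) = Γ(σ)⁻¹ ∫_0^∞ G_t^α(x,y) t^(σ-1) dt`. For `σ > 0` the integral
converges for all `x ≠ y` in the orthant; the values on the (null) diagonal play no role. -/
def potentialKernel {d : ℕ} (α : Fin d → ℝ) (σ : ℝ) (x y : Fin d → ℝ) : ℝ :=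
  (Real.Gamma σ)⁻¹ * ∫ t in Set.Ioi (0 : ℝ), heatKernel α t x y * t ^ (σ - 1)

/-- The potential operator `I^{α,σ} f(x) = ∫ K^{α,σ}(x,y) f(y) dμ_α(y)`. -/
def potential {d : ℕ} (α : Fin d → ℝ) (σ : ℝ) (f : (Fin d → ℝ) → ℂ) (x : Fin d → ℝ) : ℂ :=
  ∫ y, (potentialKernel α σ x y : ℂ) * f y ∂(mu α)

/-- The natural domain of `I^{α,σ}`: the functions for which the defining integral converges
for almost every `x` in the orthant. -/
def InDomain {d : ℕ} (α : Fin d → ℝ) (σ : ℝ) (f : (Fin d → ℝ) → ℂ) : Prop :=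
  ∀ᵐ x ∂(orthantVolume d), Integrable (fun y => (potentialKernel α σ x y : ℂ) * f y) (mu α)

/-- Boundedness of `I^{α,σ} : L^p(U dμ_α) → L^q(V dμ_α)`: every `f ∈ L^p(U dμ_α)` lies in the natural
domain, `I^{α,σ} f ∈ L^q(V dμ_α)`, and the norm inequality holds with a constant independent
of `f`. -/
def PotentialBounded {d : ℕ} (α : Fin d → ℝ) (σ : ℝ) (p q : ℝ≥0∞)
    (U V : (Fin d → ℝ) → ℝ) : Prop :=
  ∃ C : ℝ≥0, ∀ f : (Fin d → ℝ) → ℂ, MemLp f p (weightedMu U α) →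
    InDomain α σ f ∧ MemLp (potential α σ f) q (weightedMu V α) ∧
      eLpNorm (potential α σ f) q (weightedMu V α) ≤ C * eLpNorm f p (weightedMu U α)

/-- A strictly positive weight on the orthant: a measurable function, positive up to a null set. -/
def IsPosWeight {d : ℕ} (w : (Fin d → ℝ) → ℝ) : Prop :=
  AEMeasurable w (orthantVolume d) ∧ ∀ᵐ x ∂(orthantVolume d), 0 < w x

end LaguerreConv

end

noncomputable section

namespace LaguerreConv

/-! ### Elementary facts about double series and the Gamma function -/

/-! The kernels are nonnegative and, up to a constant, log-convex in the parameters: `K^{α,σ} ≤ C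
(K^{β,σ₁})^λ (K^{γ,σ₂})^(1-λ)`. Given this, the theorem follows from Hölder's inequality with
exponents `1/λ` and `1/(1-λ)`, applied once in `y` and once in `x`.

Log-convexity comes from the Hille–Hardy formula (`hasSum_hille_hardy`), which makes the heat kernel
a product over coordinates of factors `2 s^(a+1) E Φ_a((xys)²)`. Here `s` and `E` do not depend on
`a`, and `Φ_a(w) = ∑ w^k / (k! Γ(k+a+1))`. The power of `s` interpolates exactly. The series
interpolates up to a constant by Hölder for sums (`besselSeries_le`), because `Γ(k+b)^λ
Γ(k+c)^(1-λ)` and `Γ(k+λb+(1-λ)c)` are comparable uniformly in `k` (`Gamma_mul_rpow_le`). Hölder in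
`t` then gives `potentialKernel_le`.

For the operators, `|f|` is written as `g₁^λ g₂^(1-λ)` with both `gᵢ` having the same weighted norm
as `f` (`exists_splitting`). The two assumed bounds are applied to `g₁` and `g₂`, and
`lpotential_le` and `lintegral_enorm_rpow_le` combine them.

A Bochner integral that diverges has the value 0, so bounding a kernel from below needs true
convergence in `t`. The Gaussian decay in `heatFactor_le_exp` supplies it when no coordinates of `x`
and `y` coincide, hence for almost every `y`. -/

lemma hasSum_congr_real {ι : Type*} {f g : ι → ℝ} {a b : ℝ} (h : HasSum f a) (hfg : ∀ i, g i = f i)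
    (hab : b = a) : HasSum g b := by
  rw [show g = f from funext hfg, hab]
  exact h

lemma summable_congr_real {ι : Type*} {f g : ι → ℝ} (h : Summable f) (hfg : ∀ i, g i = f i) :
    Summable g := by
  rw [show g = f from funext hfg]
  exact h

/-- Fubini for absolutely convergent double series. Each generating function below is obtained by
expanding a Laguerre polynomial into monomials and summing over the degree first. -/
lemma hasSum_of_hasSum_rows_cols {f : ℕ → ℕ → ℝ} {A B : ℕ → ℝ} {S : ℝ}
    (hs : Summable fun p : ℕ × ℕ => f p.1 p.2) (h₁ : ∀ n, HasSum (f n) (A n))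
    (h₂ : ∀ j, HasSum (fun n => f n j) (B j)) (hB : HasSum B S) : HasSum A S := by
  have e : ∑' p : ℕ × ℕ, f p.1 p.2 = S := by
    have hs' : Summable fun p : ℕ × ℕ => f p.2 p.1 := hs.prod_symm
    have := HasSum.prod_fiberwise hs'.hasSum h₂
    rw [← this.unique hB]
    exact (Equiv.prodComm ℕ ℕ).tsum_eq (fun p : ℕ × ℕ => f p.2 p.1)
  exact e ▸ HasSum.prod_fiberwise hs.hasSum h₁

lemma summable_prod_of_rows {f : ℕ → ℕ → ℝ} {A : ℕ → ℝ}
    (h₁ : ∀ n, HasSum (fun j => |f n j|) (A n)) (hA : Summable A) :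
    Summable fun p : ℕ × ℕ => f p.1 p.2 := by
  have : Summable fun p : ℕ × ℕ => |f p.1 p.2| := by
    rw [summable_prod_of_nonneg (fun _ => abs_nonneg _)]
    exact ⟨fun n => (h₁ n).summable, by simpa only [(h₁ _).tsum_eq] using hA⟩
  exact this.of_abs

lemma hasSum_of_shift {f : ℕ → ℝ} {S : ℝ} (i : ℕ) (h0 : ∀ n < i, f n = 0)
    (h : HasSum (fun m => f (m + i)) S) : HasSum f S := by
  have := (hasSum_nat_add_iff i).1 h
  rwa [Finset.sum_eq_zero (fun n hn => h0 n (Finset.mem_range.1 hn)), add_zero] at this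

lemma Gamma_nat_add_pos {a : ℝ} (ha : -1 < a) (n : ℕ) : 0 < Real.Gamma (n + a + 1) := by
  apply Real.Gamma_pos_of_pos
  have : (0 : ℝ) ≤ n := n.cast_nonneg
  linarith

lemma ascPochhammer_eval_mul_Gamma {b : ℝ} (hb : 0 < b) (n : ℕ) :
    (ascPochhammer ℝ n).eval b * Real.Gamma b = Real.Gamma (n + b) := by
  induction n with
  | zero => simp
  | succ n ih =>
    rw [ascPochhammer_succ_eval, mul_right_comm, ih]
    have : (n : ℝ) + b ≠ 0 := by positivity
    push_cast
    rw [show (n : ℝ) + 1 + b = (n + b) + 1 by ring, Real.Gamma_add_one this]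
    ring

/-- The binomial series `∑ Γ(n+b)/n! r^n = Γ(b) (1-r)^(-b)`. -/
lemma hasSum_Gamma_binomial {b r : ℝ} (hb : 0 < b) (hr : |r| < 1) :
    HasSum (fun n : ℕ => Real.Gamma (n + b) / n.factorial * r ^ n)
      (Real.Gamma b * (1 - r) ^ (-b)) := by
  have h := (Real.one_div_one_sub_rpow_hasFPowerSeriesOnBall_zero b).hasSum (y := r) (by
    simpa [Metric.mem_eball, edist_zero_right, ← ofReal_norm] using hr)
  have h1 : 0 < 1 - r := by linarith [(abs_lt.1 hr).2]
  rw [zero_add, one_div, ← Real.rpow_neg h1.le] at h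
  refine hasSum_congr_real (h.mul_left (Real.Gamma b)) (fun n => ?_) rfl
  rw [FormalMultilinearSeries.ofScalars_apply_eq, ← Ring.multichoose_eq]
  have h2 := Ring.factorial_nsmul_multichoose_eq_ascPochhammer b n
  rw [Polynomial.ascPochhammer_smeval_eq_eval, nsmul_eq_mul] at h2
  rw [← ascPochhammer_eval_mul_Gamma hb, ← h2]
  have : (n.factorial : ℝ) ≠ 0 := by positivity
  simp only [smul_eq_mul]
  field_simp

/-- The factor `j + 1` pays for `a < 0`, where `Γ(j+a+1)` can be smaller than any multiple of `j!`.
After one shift of the index, each factor `j+a+2` of the Gamma recursion is at least `j+1`. -/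
lemma Gamma_lower_bound {a : ℝ} (ha : -1 < a) :
    ∃ c > 0, ∀ j : ℕ, c * j.factorial ≤ (j + 1) * Real.Gamma (j + a + 1) := by
  have h1 : ∀ j : ℕ, Real.Gamma (a + 2) * j.factorial ≤ Real.Gamma (j + 1 + a + 1) := by
    intro j
    induction j with
    | zero => simp [show (1 + a + 1 : ℝ) = a + 2 by ring]
    | succ j ih =>
      have hj : (0 : ℝ) ≤ j := j.cast_nonneg
      push_cast [Nat.factorial_succ]
      rw [Real.Gamma_add_one (by linarith), show (j : ℝ) + 1 + 1 + a = j + 1 + a + 1 by ring]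
      have : 0 < Real.Gamma (a + 2) * j.factorial :=
        mul_pos (Real.Gamma_pos_of_pos (by linarith)) (by positivity)
      nlinarith
  have p1 : 0 < Real.Gamma (a + 1) := Real.Gamma_pos_of_pos (by linarith)
  have p2 : 0 < Real.Gamma (a + 2) := Real.Gamma_pos_of_pos (by linarith)
  refine ⟨min (Real.Gamma (a + 1)) (Real.Gamma (a + 2)), lt_min p1 p2, fun j => ?_⟩
  cases j with
  | zero => simp
  | succ j =>
    have h2 := h1 j
    have : min (Real.Gamma (a + 1)) (Real.Gamma (a + 2)) * j.factorial ≤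
        Real.Gamma (a + 2) * j.factorial := by gcongr; exact min_le_right _ _
    push_cast [Nat.factorial_succ]
    have hm : 0 < min (Real.Gamma (a + 1)) (Real.Gamma (a + 2)) := lt_min p1 p2
    have hf : (0 : ℝ) < j.factorial := by positivity
    have h3 : min (Real.Gamma (a + 1)) (Real.Gamma (a + 2)) * j.factorial ≤
      Real.Gamma (j + 1 + a + 1) := this.trans h2
    have hj : (0 : ℝ) ≤ j := j.cast_nonneg
    have h4 := mul_le_mul_of_nonneg_left h3 (by linarith : (0 : ℝ) ≤ j + 1)
    have h5 : 0 ≤ Real.Gamma (j + 1 + a + 1) := (mul_nonneg hm.le hf.le).trans h3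
    nlinarith

lemma inv_Gamma_le {a : ℝ} (ha : -1 < a) :
    ∃ C > 0, ∀ j : ℕ, 1 / Real.Gamma (j + a + 1) ≤ C * ((j + 1) / j.factorial) := by
  obtain ⟨c, hc, h⟩ := Gamma_lower_bound ha
  refine ⟨c⁻¹, inv_pos.2 hc, fun j => ?_⟩
  have hG := Gamma_nat_add_pos ha j
  have hf : (0 : ℝ) < j.factorial := by positivity
  rw [div_le_iff₀ hG]
  field_simp
  linarith [h j]

lemma summable_pow_div_Gamma {a : ℝ} (ha : -1 < a) (w : ℝ) :
    Summable fun j : ℕ => w ^ j / Real.Gamma (j + a + 1) := by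
  obtain ⟨C, hC, h⟩ := inv_Gamma_le ha
  have hs : Summable fun j : ℕ => C * ((2 * |w|) ^ j / j.factorial) :=
    (Real.summable_pow_div_factorial (2 * |w|)).mul_left C
  refine Summable.of_norm_bounded hs (fun j => ?_)
  have hG := Gamma_nat_add_pos ha j
  rw [norm_div, norm_pow, Real.norm_eq_abs, Real.norm_eq_abs, abs_of_pos hG, div_eq_mul_one_div,
    mul_pow]
  have h2 : ((j : ℝ) + 1) ≤ 2 ^ j := by exact_mod_cast Nat.lt_two_pow_self (n := j)
  calc |w| ^ j * (1 / Real.Gamma (j + a + 1)) ≤ |w| ^ j * (C * (2 ^ j / j.factorial)) := by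
        gcongr
        exact (h j).trans (by gcongr)
    _ = _ := by ring

/-! ### The entire function `∑ w^k / (k! Γ(k+a+1))` -/

/-- The entire function `Φ_a(w) = ∑_k w^k / (k! Γ(k+a+1))`, so that
`I_a(z) = (z/2)^a Φ_a(z²/4)`. -/
def besselSeries (a w : ℝ) : ℝ := ∑' k : ℕ, w ^ k / (k.factorial * Real.Gamma (k + a + 1))

lemma hasSum_besselSeries {a : ℝ} (ha : -1 < a) (w : ℝ) :
    HasSum (fun k : ℕ => w ^ k / (k.factorial * Real.Gamma (k + a + 1))) (besselSeries a w) := by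
  apply Summable.hasSum
  refine Summable.of_norm_bounded (summable_pow_div_Gamma ha w).norm (fun j => ?_)
  have hG := Gamma_nat_add_pos ha j
  have hf : (1 : ℝ) ≤ j.factorial := by exact_mod_cast Nat.one_le_iff_ne_zero.2 j.factorial_ne_zero
  rw [norm_div, norm_div, norm_mul, Real.norm_natCast]
  have : 0 < ‖Real.Gamma (j + a + 1)‖ := norm_pos_iff.2 hG.ne'
  gcongr
  nlinarith

/-! ### Laguerre polynomials: growth and generating functions -/

/-- The Laguerre polynomial normalised by `Γ(n+a+1)/n!`. -/
def laguerreRenorm (n : ℕ) (a u : ℝ) : ℝ :=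
  ∑ j ∈ Finset.range (n + 1), n.choose j * ((-u) ^ j / Real.Gamma (j + a + 1))

lemma hasSum_laguerreRenorm (n : ℕ) (a u : ℝ) :
    HasSum (fun j => n.choose j * ((-u) ^ j / Real.Gamma (j + a + 1))) (laguerreRenorm n a u) := by
  apply hasSum_sum_of_ne_finset_zero
  intro j hj
  rw [Nat.choose_eq_zero_of_lt (by simpa using hj)]
  simp

lemma laguerrePoly_eq_renorm {a : ℝ} (n : ℕ) (u : ℝ) :
    laguerrePoly n a u = Real.Gamma (n + a + 1) / n.factorial * laguerreRenorm n a u := by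
  rw [laguerrePoly, laguerreRenorm, Finset.mul_sum]
  refine Finset.sum_congr rfl fun j hj => ?_
  rw [Nat.cast_choose ℝ (by simpa [Nat.lt_succ_iff] using hj)]
  have h1 : (n.factorial : ℝ) ≠ 0 := by positivity
  field_simp

lemma abs_laguerreRenorm_le {a : ℝ} (ha : -1 < a) (n : ℕ) (u : ℝ) :
    |laguerreRenorm n a u| ≤ laguerreRenorm n a (-|u|) := by
  refine (Finset.abs_sum_le_sum_abs _ _).trans (Finset.sum_le_sum fun j _ => ?_)
  rw [abs_mul, abs_div, abs_pow, abs_neg, neg_neg, Nat.abs_cast,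
    abs_of_pos (Gamma_nat_add_pos ha j)]

lemma hasSum_abs_laguerreRenorm {a : ℝ} (ha : -1 < a) (n : ℕ) (u : ℝ) :
    HasSum (fun j => |n.choose j * ((-u) ^ j / Real.Gamma (j + a + 1))|)
      (laguerreRenorm n a (-|u|)) := by
  refine hasSum_congr_real (hasSum_laguerreRenorm n a (-|u|)) (fun j => ?_) rfl
  rw [abs_mul, abs_div, abs_pow, abs_neg, neg_neg, Nat.abs_cast,
    abs_of_pos (Gamma_nat_add_pos ha j)]

/-- Growth is slower than any exponential: compare termwise with the binomial expansion of
`(1+ε)^n`, using that `(|u|/ε)^j / Γ(j+a+1)` is bounded in `j`. -/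
lemma laguerreRenorm_growth {a : ℝ} (ha : -1 < a) (u : ℝ) {ε : ℝ} (hε : 0 < ε) :
    ∃ B > 0, ∀ n : ℕ, laguerreRenorm n a (-|u|) ≤ B * (1 + ε) ^ n := by
  obtain ⟨B, hB⟩ := (summable_pow_div_Gamma ha (|u| / ε)).tendsto_atTop_zero.bddAbove_range
  refine ⟨max B 1, by positivity, fun n => ?_⟩
  rw [laguerreRenorm, add_comm 1 ε, add_pow, Finset.mul_sum]
  refine Finset.sum_le_sum fun j _ => ?_
  have h1 : (|u| / ε) ^ j / Real.Gamma (j + a + 1) ≤ max B 1 :=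
    (hB ⟨j, rfl⟩).trans (le_max_left _ _)
  rw [neg_neg]
  calc (n.choose j : ℝ) * (|u| ^ j / Real.Gamma (j + a + 1))
      = n.choose j * ε ^ j * ((|u| / ε) ^ j / Real.Gamma (j + a + 1)) := by
        rw [div_pow]
        field_simp
    _ ≤ n.choose j * ε ^ j * max B 1 := by gcongr
    _ = _ := by ring

lemma exists_one_add_sq_mul_lt {r : ℝ} (hr : r < 1) :
    ∃ ε > 0, r * (1 + ε) ^ 2 < 1 := by
  refine ⟨(1 - r) / 4, by linarith, ?_⟩
  nlinarith [mul_self_nonneg r]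

/-- Each Laguerre factor costs `(1+ε)^n`; with `r(1+ε)² < 1` a convergent binomial series still
dominates. -/
lemma summable_Gamma_laguerreRenorm_mul {a : ℝ} (ha : -1 < a) (u v : ℝ) {r : ℝ} (hr0 : 0 ≤ r)
    (hr : r < 1) : Summable fun n : ℕ => Real.Gamma (n + a + 1) / n.factorial * r ^ n *
      (laguerreRenorm n a (-|u|) * laguerreRenorm n a (-|v|)) := by
  obtain ⟨ε, hε, h⟩ := exists_one_add_sq_mul_lt hr
  obtain ⟨B, hB, h1⟩ := laguerreRenorm_growth ha u hε
  obtain ⟨B', hB', h2⟩ := laguerreRenorm_growth ha v hε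
  have hs := (hasSum_Gamma_binomial (b := a + 1) (r := r * (1 + ε) ^ 2) (by linarith)
    (by rwa [abs_of_nonneg (by positivity)])).summable.mul_left (B * B')
  have hG := fun n => Gamma_nat_add_pos ha n
  have hn := fun n (u : ℝ) => (abs_nonneg _).trans (abs_laguerreRenorm_le ha n u)
  refine Summable.of_nonneg_of_le (fun n => ?_) (fun n => ?_) hs
  · have := hG n
    have := hn n u
    have := hn n v
    positivity
  · have := hG n
    calc Real.Gamma (n + a + 1) / n.factorial * r ^ n *
        (laguerreRenorm n a (-|u|) * laguerreRenorm n a (-|v|))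
        ≤ Real.Gamma (n + a + 1) / n.factorial * r ^ n *
          ((B * (1 + ε) ^ n) * (B' * (1 + ε) ^ n)) := by
          gcongr
          · exact hn n v
          · exact h1 n
          · exact h2 n
      _ = _ := by rw [add_assoc, mul_pow, ← pow_mul, mul_comm 2 n, pow_mul]; ring

lemma summable_Gamma_laguerreRenorm {a : ℝ} (ha : -1 < a) (u : ℝ) {r : ℝ} (hr0 : 0 ≤ r)
    (hr : r < 1) : Summable fun n : ℕ => Real.Gamma (n + a + 1) / n.factorial * r ^ n *
      laguerreRenorm n a (-|u|) := by
  -- At `v = 0` the second Laguerre factor is the constant `1/Γ(a+1)`, which can be divided out.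
  have h := summable_Gamma_laguerreRenorm_mul ha u 0 hr0 hr
  have e : ∀ n, laguerreRenorm n a (-|0|) = 1 / Real.Gamma (a + 1) := by
    intro n
    rw [laguerreRenorm, Finset.sum_eq_single 0]
    · simp
    · intro j _ hj; simp [hj]
    · simp
  have hG : Real.Gamma (a + 1) ≠ 0 := (Real.Gamma_pos_of_pos (by linarith)).ne'
  refine summable_congr_real (h.mul_right (Real.Gamma (a + 1))) (fun n => ?_)
  rw [e]
  field_simp

/-- `∑ L_n^a(u) w^n = (1-w)^(-a-1) exp(-uw/(1-w))`. -/
lemma hasSum_laguerre_generating {a : ℝ} (ha : -1 < a) (u : ℝ) {w : ℝ} (hw : |w| < 1) :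
    HasSum (fun n => laguerrePoly n a u * w ^ n)
      ((1 - w) ^ (-(a + 1)) * Real.exp (-u * w / (1 - w))) := by
  have hw1 : 0 < 1 - w := by linarith [(abs_lt.1 hw).2]
  have hG := fun n => Gamma_nat_add_pos ha n
  -- Rows are expansions in powers of `u`; column `j` vanishes for `n < j` and is then a binomial
  -- series with parameter `j+a+1`.
  let f : ℕ → ℕ → ℝ := fun n j => (Real.Gamma (n + a + 1) / n.factorial * w ^ n) *
    (n.choose j * ((-u) ^ j / Real.Gamma (j + a + 1)))
  refine hasSum_of_hasSum_rows_cols (f := f)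
    (B := fun i => (1 - w) ^ (-(a + 1)) * ((-u * w / (1 - w)) ^ i / i.factorial)) ?_ ?_ ?_ ?_
  · refine summable_prod_of_rows (A := fun n => Real.Gamma (n + a + 1) / n.factorial * |w| ^ n *
      laguerreRenorm n a (-|u|)) (fun n => ?_) (summable_Gamma_laguerreRenorm ha u (abs_nonneg w) hw)
    refine hasSum_congr_real ((hasSum_abs_laguerreRenorm ha n u).mul_left
      (Real.Gamma (n + a + 1) / n.factorial * |w| ^ n)) (fun j => ?_) rfl
    rw [abs_mul, abs_mul, abs_div, abs_pow, Nat.abs_cast, abs_of_pos (hG n)]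
  · intro n
    refine hasSum_congr_real ((hasSum_laguerreRenorm n a u).mul_left
      (Real.Gamma (n + a + 1) / n.factorial * w ^ n)) (fun j => rfl) ?_
    rw [laguerrePoly_eq_renorm]; ring
  · intro j
    apply hasSum_of_shift j
    · intro n hn
      simp [f, Nat.choose_eq_zero_of_lt hn]
    · have h := (hasSum_Gamma_binomial (b := j + a + 1) (r := w)
        (by have : (0 : ℝ) ≤ j := j.cast_nonneg
            linarith) hw).mul_left (w ^ j / j.factorial * ((-u) ^ j / Real.Gamma (j + a + 1)))
      refine hasSum_congr_real h (fun m => ?_) ?_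
      · simp only [f]
        rw [Nat.cast_choose ℝ (by omega), Nat.add_sub_cancel, pow_add]
        push_cast
        rw [show (m : ℝ) + j + a + 1 = m + (j + a + 1) by ring]
        have : ((m + j).factorial : ℝ) ≠ 0 := by positivity
        field_simp
      · have : Real.Gamma (j + a + 1) ≠ 0 := (hG j).ne'
        rw [show -((j : ℝ) + a + 1) = -(a + 1) - j by ring, Real.rpow_sub hw1, Real.rpow_natCast,
          div_pow, mul_pow]
        field_simp
  · apply HasSum.mul_left
    rw [Real.exp_eq_exp_ℝ]
    exact NormedSpace.expSeries_div_hasSum_exp _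

/-- `∑ L_n^a(u) w^n / Γ(n+a+1) = e^w Φ_a(-uw)`. -/
lemma hasSum_laguerre_bessel {a : ℝ} (ha : -1 < a) (u w : ℝ) :
    HasSum (fun n : ℕ => laguerrePoly n a u * (w ^ n / Real.Gamma (n + a + 1)))
      (Real.exp w * besselSeries a (-u * w)) := by
  have hG := fun n => Gamma_nat_add_pos ha n
  -- Division by `Γ(n+a+1)` leaves `C(n,j)/n!`, so each column is a shifted exponential series.
  let f : ℕ → ℕ → ℝ := fun n j => (w ^ n / n.factorial) *
    (n.choose j * ((-u) ^ j / Real.Gamma (j + a + 1)))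
  refine hasSum_of_hasSum_rows_cols (f := f)
    (B := fun i => Real.exp w * ((-u * w) ^ i / (i.factorial * Real.Gamma (i + a + 1)))) ?_ ?_ ?_ ?_
  · refine summable_prod_of_rows (A := fun n => |w| ^ n / n.factorial *
      laguerreRenorm n a (-|u|)) (fun n => ?_) ?_
    · refine hasSum_congr_real ((hasSum_abs_laguerreRenorm ha n u).mul_left (|w| ^ n / n.factorial))
        (fun j => ?_) rfl
      rw [abs_mul, abs_div, abs_pow, Nat.abs_cast]
    · obtain ⟨B, hB, h⟩ := laguerreRenorm_growth ha u one_pos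
      refine Summable.of_nonneg_of_le (fun n => ?_) (fun n => ?_)
        ((Real.summable_pow_div_factorial (|w| * (1 + 1))).mul_left B)
      · have := (abs_nonneg _).trans (abs_laguerreRenorm_le ha n u)
        positivity
      · calc |w| ^ n / n.factorial * laguerreRenorm n a (-|u|)
            ≤ |w| ^ n / n.factorial * (B * (1 + 1) ^ n) := by gcongr; exact h n
          _ = _ := by rw [mul_pow]; ring
  · intro n
    refine hasSum_congr_real ((hasSum_laguerreRenorm n a u).mul_left (w ^ n / n.factorial))
      (fun j => rfl) ?_
    rw [laguerrePoly_eq_renorm]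
    have := (hG n).ne'
    field_simp
  · intro j
    apply hasSum_of_shift j
    · intro n hn
      simp [f, Nat.choose_eq_zero_of_lt hn]
    · have h := (NormedSpace.expSeries_div_hasSum_exp w).mul_left
        (w ^ j / j.factorial * ((-u) ^ j / Real.Gamma (j + a + 1)))
      rw [← Real.exp_eq_exp_ℝ] at h
      refine hasSum_congr_real h (fun m => ?_) ?_
      · simp only [f]
        rw [Nat.cast_choose ℝ (by omega), Nat.add_sub_cancel, pow_add]
        have : ((m + j).factorial : ℝ) ≠ 0 := by positivity
        field_simp
      · have : Real.Gamma (j + a + 1) ≠ 0 := (hG j).ne'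
        rw [mul_pow]
        field_simp
  · exact (hasSum_besselSeries ha _).mul_left _

/-! ### The Hille–Hardy formula -/

/-- Uniqueness of power series coefficients, used to read off an identity from two expansions of one
function. -/
lemma eq_of_hasSum_pow_eventuallyEq {b c : ℕ → ℝ} {F : ℝ → ℝ}
    (hb : ∀ᶠ h in nhds (0 : ℝ), HasSum (fun j => b j * h ^ j) (F h))
    (hc : ∀ᶠ h in nhds (0 : ℝ), HasSum (fun j => c j * h ^ j) (F h)) : b = c := by
  have key : ∀ d : ℕ → ℝ, (∀ᶠ h in nhds (0 : ℝ), HasSum (fun j => d j * h ^ j) (F h)) →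
      HasFPowerSeriesAt F (FormalMultilinearSeries.ofScalars ℝ d) 0 := by
    intro d hd
    rw [hasFPowerSeriesAt_iff]
    filter_upwards [hd] with h hh
    rw [zero_add]
    refine hasSum_congr_real hh (fun j => ?_) rfl
    simp [FormalMultilinearSeries.coeff_ofScalars, mul_comm]
  have := (key b hb).eq_formalMultilinearSeries (key c hc)
  ext j
  simpa [FormalMultilinearSeries.coeff_ofScalars] using
    congrArg (fun p : FormalMultilinearSeries ℝ ℝ ℝ => p.coeff j) this

lemma hasSum_choose_mul_pow (n : ℕ) (r h : ℝ) :
    HasSum (fun j => (n.choose j : ℝ) * r ^ (n - j) * h ^ j) ((r + h) ^ n) := by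
  rw [add_comm r h, add_pow]
  refine hasSum_congr_real (hasSum_sum_of_ne_finset_zero
    (s := Finset.range (n + 1)) (f := fun j => h ^ j * r ^ (n - j) * (n.choose j : ℝ)) ?_)
    (fun j => by ring) rfl
  intro j hj
  rw [Nat.choose_eq_zero_of_lt (by simpa using hj)]
  simp

lemma summable_abs_laguerrePoly_mul_pow {a : ℝ} (ha : -1 < a) (u : ℝ) {r : ℝ} (hr0 : 0 ≤ r)
    (hr : r < 1) : Summable fun n : ℕ => |laguerrePoly n a u| * r ^ n := by
  refine Summable.of_nonneg_of_le (fun n => by positivity) (fun n => ?_)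
    (summable_Gamma_laguerreRenorm ha u hr0 hr)
  have hG := Gamma_nat_add_pos ha n
  rw [laguerrePoly_eq_renorm, abs_mul, abs_div, Nat.abs_cast, abs_of_pos hG]
  calc _ = Real.Gamma (n + a + 1) / n.factorial * r ^ n * |laguerreRenorm n a u| := by ring
    _ ≤ _ := by gcongr; exact abs_laguerreRenorm_le ha n u

lemma summable_laguerrePoly_choose {a : ℝ} (ha : -1 < a) (u : ℝ) {r h : ℝ} (hr0 : 0 ≤ r)
    (hr : r + |h| < 1) :
    Summable fun p : ℕ × ℕ =>
      laguerrePoly p.1 a u * ((p.1.choose p.2 : ℝ) * r ^ (p.1 - p.2) * h ^ p.2) := by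
  refine summable_prod_of_rows
    (f := fun n j => laguerrePoly n a u * ((n.choose j : ℝ) * r ^ (n - j) * h ^ j))
    (A := fun n => |laguerrePoly n a u| * (r + |h|) ^ n) (fun n => ?_)
    (summable_abs_laguerrePoly_mul_pow ha u (by positivity) hr)
  refine hasSum_congr_real ((hasSum_choose_mul_pow n r |h|).mul_left |laguerrePoly n a u|)
    (fun j => ?_) rfl
  rw [abs_mul, abs_mul, abs_mul, Nat.abs_cast, abs_pow, abs_pow, abs_of_nonneg hr0]

/-- `∑ₙ C(n,j) L_n^a(u) r^(n-j) = (1-r)^(-a-1-j) exp(-ur/(1-r)) L_j^a(u/(1-r))`. -/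
lemma hasSum_laguerre_choose {a : ℝ} (ha : -1 < a) (u : ℝ) {r : ℝ} (hr0 : 0 ≤ r) (hr : r < 1)
    (j : ℕ) : HasSum (fun n : ℕ => laguerrePoly n a u * ((n.choose j : ℝ) * r ^ (n - j)))
      ((1 - r) ^ (-(a + 1)) * Real.exp (-u * r / (1 - r)) *
        laguerrePoly j a (u / (1 - r)) * ((1 - r)⁻¹) ^ j) := by
  have h1 : 0 < 1 - r := by linarith
  set b : ℕ → ℝ := fun j => ∑' n : ℕ, laguerrePoly n a u * ((n.choose j : ℝ) * r ^ (n - j)) with hb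
  have hbs : ∀ j, HasSum (fun n : ℕ => laguerrePoly n a u * ((n.choose j : ℝ) * r ^ (n - j)))
      (b j) := by
    intro j
    -- Any nonzero increment with `r + |h| < 1` serves; its power `h^j` is divided out of the
    -- summable column.
    have hlt : r + |(1 - r) / 2| < 1 := by rw [abs_of_pos (by positivity)]; linarith
    have hs := summable_laguerrePoly_choose ha u hr0 hlt
    have h2 := (hs.prod_symm.prod_factor j).mul_right ((((1 - r) / 2) ^ j)⁻¹)
    refine (summable_congr_real h2 fun n => ?_).hasSum
    simp only [Prod.swap_prod_mk]
    have : ((1 - r) / 2) ^ j ≠ 0 := by positivity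
    field_simp
  have hev : ∀ᶠ h in nhds (0 : ℝ), |h| < 1 - r := by
    have : Filter.Tendsto (fun h : ℝ => |h|) (nhds 0) (nhds |0|) := continuous_abs.tendsto 0
    rw [abs_zero] at this
    exact this.eventually (gt_mem_nhds h1)
  -- The generating function at `r + h` is expanded in `h` in two ways: through the binomial
  -- theorem, and through `1-(r+h) = (1-r)(1-h/(1-r))`, which gives a generating function at
  -- `u/(1-r)` in the variable `h/(1-r)`.
  have := eq_of_hasSum_pow_eventuallyEq (b := b) (c := fun j => (1 - r) ^ (-(a + 1)) *
      Real.exp (-u * r / (1 - r)) * laguerrePoly j a (u / (1 - r)) * ((1 - r)⁻¹) ^ j)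
    (F := fun h => (1 - (r + h)) ^ (-(a + 1)) * Real.exp (-u * (r + h) / (1 - (r + h)))) ?_ ?_
  · have hj := hbs j
    rwa [congrFun this j] at hj
  · filter_upwards [hev] with h hh
    have hs := summable_laguerrePoly_choose ha u hr0 (h := h) (by linarith)
    have habs : |r + h| < 1 := by
      calc |r + h| ≤ |r| + |h| := abs_add_le _ _
        _ < 1 := by rw [abs_of_nonneg hr0]; linarith
    have h3 := hasSum_laguerre_generating ha u habs
    have h4 := fun n => (hasSum_choose_mul_pow n r h).mul_left (laguerrePoly n a u)
    have h5 : ∀ j, HasSum (fun n => laguerrePoly n a u * ((n.choose j : ℝ) * r ^ (n - j) * h ^ j))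
        (b j * h ^ j) := fun j =>
      hasSum_congr_real ((hbs j).mul_right (h ^ j)) (fun n => by ring) rfl
    have h6 : Summable fun j => b j * h ^ j :=
      (HasSum.prod_fiberwise hs.prod_symm.hasSum h5).summable
    have h7 := hasSum_of_hasSum_rows_cols hs h4 h5 h6.hasSum
    exact hasSum_congr_real h6.hasSum (fun j => rfl) (h3.unique h7)
  · filter_upwards [hev] with h hh
    have h0 : 0 < 1 - (r + h) := by linarith [le_abs_self h]
    have habs : |h / (1 - r)| < 1 := by rwa [abs_div, abs_of_pos h1, div_lt_one h1]
    have h3 := (hasSum_laguerre_generating ha (u / (1 - r)) habs).mul_left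
      ((1 - r) ^ (-(a + 1)) * Real.exp (-u * r / (1 - r)))
    refine hasSum_congr_real h3 (fun j => ?_) ?_
    · rw [div_pow, inv_pow]; ring
    · have e1 : 1 - (r + h) = (1 - r) * (1 - h / (1 - r)) := by field_simp; ring
      have e2 : 0 ≤ 1 - h / (1 - r) := by linarith [(abs_lt.1 habs).2]
      rw [mul_mul_mul_comm, ← Real.exp_add, ← Real.mul_rpow h1.le e2, ← e1]
      congr 2
      have e3 : 1 - h / (1 - r) ≠ 0 := by
        have := e1 ▸ h0.ne'
        exact right_ne_zero_of_mul this
      have e4 : 1 - r - h ≠ 0 := by linarith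
      have e5 : 1 - h / (1 - r) = (1 - r - h) / (1 - r) := by field_simp
      rw [e5, show 1 - (r + h) = 1 - r - h by ring]
      field_simp
      ring

/-- The Hille–Hardy formula. -/
lemma hasSum_hille_hardy {a : ℝ} (ha : -1 < a) (u v : ℝ) {r : ℝ} (hr0 : 0 ≤ r) (hr : r < 1) :
    HasSum (fun n : ℕ => r ^ n * (n.factorial / Real.Gamma (n + a + 1)) *
        (laguerrePoly n a u * laguerrePoly n a v))
      ((1 - r) ^ (-(a + 1)) * Real.exp (-(u + v) * r / (1 - r)) *
        besselSeries a (u * v * r / (1 - r) ^ 2)) := by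
  have h1 : 0 < 1 - r := by linarith
  have hG := fun n => Gamma_nat_add_pos ha n
  -- Only the polynomial in `v` is expanded. Column sums come from `hasSum_laguerre_choose`, and the
  -- remaining sum over `j` is `hasSum_laguerre_bessel`.
  let f : ℕ → ℕ → ℝ := fun n j => (laguerrePoly n a u * r ^ n) *
    (n.choose j * ((-v) ^ j / Real.Gamma (j + a + 1)))
  refine hasSum_of_hasSum_rows_cols (f := f)
    (B := fun j => (1 - r) ^ (-(a + 1)) * Real.exp (-u * r / (1 - r)) *
      (laguerrePoly j a (u / (1 - r)) * ((-v * r / (1 - r)) ^ j / Real.Gamma (j + a + 1))))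
    ?_ ?_ ?_ ?_
  · refine summable_prod_of_rows (A := fun n => |laguerrePoly n a u| * r ^ n *
      laguerreRenorm n a (-|v|)) (fun n => ?_) ?_
    · refine hasSum_congr_real ((hasSum_abs_laguerreRenorm ha n v).mul_left
        (|laguerrePoly n a u| * r ^ n)) (fun j => ?_) rfl
      rw [abs_mul, abs_mul, abs_pow, abs_of_nonneg hr0]
    · have hp := fun n => (abs_nonneg _).trans (abs_laguerreRenorm_le ha n v)
      refine Summable.of_nonneg_of_le (fun n => ?_) (fun n => ?_)
        (summable_Gamma_laguerreRenorm_mul ha u v hr0 hr)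
      · have := hp n
        positivity
      · have h2 := hG n
        rw [laguerrePoly_eq_renorm, abs_mul, abs_div, Nat.abs_cast, abs_of_pos h2]
        calc _ = Real.Gamma (n + a + 1) / n.factorial * r ^ n *
              (|laguerreRenorm n a u| * laguerreRenorm n a (-|v|)) := by ring
          _ ≤ _ := by
            gcongr
            · exact hp n
            · exact abs_laguerreRenorm_le ha n u
  · intro n
    refine hasSum_congr_real ((hasSum_laguerreRenorm n a v).mul_left (laguerrePoly n a u * r ^ n))
      (fun j => rfl) ?_
    rw [laguerrePoly_eq_renorm n v]
    have := (hG n).ne'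
    field_simp
  · intro j
    refine hasSum_congr_real ((hasSum_laguerre_choose ha u hr0 hr j).mul_left
      (r ^ j * ((-v) ^ j / Real.Gamma (j + a + 1)))) (fun n => ?_) ?_
    · simp only [f]
      rcases lt_or_ge n j with hn | hn
      · simp [Nat.choose_eq_zero_of_lt hn]
      · rw [← Nat.sub_add_cancel hn, pow_add]
        simp only [Nat.add_sub_cancel]
        ring
    · rw [div_pow, mul_pow, inv_pow]
      ring
  · refine hasSum_congr_real ((hasSum_laguerre_bessel ha (u / (1 - r)) (-v * r / (1 - r))).mul_left
      ((1 - r) ^ (-(a + 1)) * Real.exp (-u * r / (1 - r)))) (fun j => rfl) ?_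
    rw [mul_mul_mul_comm, mul_mul_mul_comm]
    have e1 : -(u + v) * r / (1 - r) = -u * r / (1 - r) + -v * r / (1 - r) := by ring
    have e2 : -(u / (1 - r)) * (-v * r / (1 - r)) = u * v * r / (1 - r) ^ 2 := by
      field_simp
    rw [e1, Real.exp_add, e2]
    ring

/-! ### Closed form of the heat kernel -/

/-- `1 / (2 sinh (2t))`. -/
def heatScale (t : ℝ) : ℝ := Real.exp (-2 * t) / (1 - Real.exp (-4 * t))

lemma exp_neg_four_eq (t : ℝ) : Real.exp (-4 * t) = Real.exp (-2 * t) ^ 2 := by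
  rw [← Real.exp_nat_mul]; congr 1; push_cast; ring

lemma exp_neg_two_lt_one {t : ℝ} (ht : 0 < t) : Real.exp (-2 * t) < 1 :=
  Real.exp_lt_one_iff.2 (by linarith)

lemma exp_neg_four_lt_one {t : ℝ} (ht : 0 < t) : Real.exp (-4 * t) < 1 :=
  Real.exp_lt_one_iff.2 (by linarith)

lemma heatScale_pos {t : ℝ} (ht : 0 < t) : 0 < heatScale t :=
  div_pos (Real.exp_pos _) (by linarith [exp_neg_four_lt_one ht])

/-- The closed form of the one-dimensional heat kernel. -/
def heatFactor (a t x y : ℝ) : ℝ :=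
  2 * heatScale t ^ (a + 1) *
    Real.exp (-(x ^ 2 + y ^ 2) * (1 / 2 + Real.exp (-4 * t) / (1 - Real.exp (-4 * t)))) *
    besselSeries a ((x * y * heatScale t) ^ 2)

lemma laguerreFun₁_mul {a : ℝ} (ha : -1 < a) (n : ℕ) (x y : ℝ) :
    laguerreFun₁ n a x * laguerreFun₁ n a y = 2 * (n.factorial / Real.Gamma (n + a + 1)) *
      (laguerrePoly n a (x ^ 2) * laguerrePoly n a (y ^ 2)) * Real.exp (-(x ^ 2 + y ^ 2) / 2) := by
  have hG := Gamma_nat_add_pos ha n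
  have h0 : 0 ≤ 2 * Real.Gamma (n + 1) / Real.Gamma (n + a + 1) := by
    rw [Real.Gamma_nat_eq_factorial]; positivity
  rw [laguerreFun₁, laguerreFun₁, show -(x ^ 2 + y ^ 2) / 2 = -(x ^ 2) / 2 + -(y ^ 2) / 2 by ring,
    Real.exp_add]
  calc _ = (Real.sqrt (2 * Real.Gamma (n + 1) / Real.Gamma (n + a + 1)) *
        Real.sqrt (2 * Real.Gamma (n + 1) / Real.Gamma (n + a + 1))) *
        (laguerrePoly n a (x ^ 2) * laguerrePoly n a (y ^ 2)) *
        (Real.exp (-(x ^ 2) / 2) * Real.exp (-(y ^ 2) / 2)) := by ring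
    _ = _ := by rw [Real.mul_self_sqrt h0, Real.Gamma_nat_eq_factorial]; ring

lemma hasSum_heatFactor {a t : ℝ} (ha : -1 < a) (ht : 0 < t) (x y : ℝ) :
    HasSum (fun n : ℕ => Real.exp (-t * (4 * n + 2 * a + 2)) *
      (laguerreFun₁ n a x * laguerreFun₁ n a y)) (heatFactor a t x y) := by
  have hr := exp_neg_four_lt_one ht
  -- Hille–Hardy with `r = exp(-4t)`, `u = x²`, `v = y²`.
  refine hasSum_congr_real ((hasSum_hille_hardy ha (x ^ 2) (y ^ 2) (Real.exp_pos _).le hr).mul_left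
    (2 * Real.exp (-2 * t) ^ (a + 1) * Real.exp (-(x ^ 2 + y ^ 2) / 2))) (fun n => ?_) ?_
  · have e : Real.exp (-t * (4 * n + 2 * a + 2)) =
        Real.exp (-4 * t) ^ n * Real.exp (-2 * t) ^ (a + 1) := by
      rw [← Real.exp_nat_mul, ← Real.exp_mul, ← Real.exp_add]
      congr 1; ring
    rw [laguerreFun₁_mul ha, e]
    ring
  · have h1 : 0 < 1 - Real.exp (-4 * t) := by linarith
    have e1 : (x * y * heatScale t) ^ 2 =
        x ^ 2 * y ^ 2 * Real.exp (-4 * t) / (1 - Real.exp (-4 * t)) ^ 2 := by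
      rw [heatScale, mul_pow, mul_pow, div_pow, ← exp_neg_four_eq]; ring
    have e2 : -(x ^ 2 + y ^ 2) * (1 / 2 + Real.exp (-4 * t) / (1 - Real.exp (-4 * t))) =
        -(x ^ 2 + y ^ 2) / 2 + -(x ^ 2 + y ^ 2) * Real.exp (-4 * t) / (1 - Real.exp (-4 * t)) := by
      ring
    rw [heatFactor, e1, e2, Real.exp_add, heatScale, Real.div_rpow (Real.exp_pos _).le h1.le,
      Real.rpow_neg h1.le, div_eq_mul_inv]
    ring

lemma hasSum_pi_prod : ∀ {d : ℕ} {f : Fin d → ℕ → ℝ} {S : Fin d → ℝ} (_ : ∀ i, HasSum (f i) (S i)),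
    HasSum (fun k : Fin d → ℕ => ∏ i, f i (k i)) (∏ i, S i)
  | 0, f, S, h => by
    simp only [Finset.univ_eq_empty, Finset.prod_empty]
    exact hasSum_unique (fun _ : Fin 0 → ℕ => (1 : ℝ))
  | d + 1, f, S, h => by
    have ih := hasSum_pi_prod (fun i : Fin d => h i.succ)
    have h0 := h 0
    have hs := summable_mul_of_summable_norm h0.summable.norm ih.summable.norm
    have hm := h0.mul ih hs
    rw [Fin.prod_univ_succ]
    rw [← (Fin.consEquiv (fun _ : Fin (d + 1) => ℕ)).hasSum_iff]
    refine hasSum_congr_real hm (fun p => ?_) rfl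
    simp [Fin.prod_univ_succ, Fin.consEquiv]

/-- The closed form of the heat kernel. -/
def heatProd {d : ℕ} (α : Fin d → ℝ) (t : ℝ) (x y : Fin d → ℝ) : ℝ :=
  ∏ i, heatFactor (α i) t (x i) (y i)

lemma heatKernel_eq_heatProd {d : ℕ} {α : Fin d → ℝ} (hα : ∀ i, -1 < α i) {t : ℝ} (ht : 0 < t)
    (x y : Fin d → ℝ) : heatKernel α t x y = heatProd α t x y := by
  -- The exponents `4kᵢ + 2αᵢ + 2` add up to one that depends on `k` only through `|k|`, so the
  -- product series is grouped along the fibres `|k| = n`.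
  have h := (hasSum_pi_prod fun i => hasSum_heatFactor (hα i) ht (x i) (y i)).tsum_fiberwise
    (fun k => ∑ i, k i)
  rw [heatKernel, heatProd, ← h.tsum_eq]
  refine tsum_congr fun n => ?_
  have e : (fun k : Fin d → ℕ => ∑ i, k i) ⁻¹' {n} =
      ↑(Finset.piAntidiag (Finset.univ : Finset (Fin d)) n) := by
    ext k; simp
  rw [e, Finset.tsum_subtype' (Finset.piAntidiag (Finset.univ : Finset (Fin d)) n)
    (fun k : Fin d → ℕ => ∏ i, Real.exp (-t * (4 * (k i : ℝ) + 2 * α i + 2)) *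
      (laguerreFun₁ (k i) (α i) (x i) * laguerreFun₁ (k i) (α i) (y i))), Finset.mul_sum]
  refine Finset.sum_congr rfl fun k hk => ?_
  have hk' : ∑ i, k i = n := by simpa using hk
  rw [Finset.prod_mul_distrib, Finset.prod_mul_distrib, laguerreFun, laguerreFun, ← Real.exp_sum,
    ← Finset.mul_sum, Finset.sum_add_distrib, Finset.sum_add_distrib, ← Finset.mul_sum,
    ← Finset.mul_sum, ← hk']
  simp [mul_comm]

lemma potentialKernel_eq {d : ℕ} {α : Fin d → ℝ} (hα : ∀ i, -1 < α i) (σ : ℝ) (x y : Fin d → ℝ) :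
    potentialKernel α σ x y =
      (Real.Gamma σ)⁻¹ * ∫ t in Set.Ioi (0 : ℝ), heatProd α t x y * t ^ (σ - 1) := by
  rw [potentialKernel]
  congr 1
  exact setIntegral_congr_fun measurableSet_Ioi fun t ht => by
    simp only [heatKernel_eq_heatProd hα ht]

/-! ### Positivity and measurability -/

lemma besselSeries_nonneg {a w : ℝ} (ha : -1 < a) (hw : 0 ≤ w) : 0 ≤ besselSeries a w :=
  tsum_nonneg fun k => div_nonneg (pow_nonneg hw k)
    (mul_nonneg (Nat.cast_nonneg _) (Gamma_nat_add_pos ha k).le)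

lemma heatFactor_nonneg {a t : ℝ} (ha : -1 < a) (ht : 0 < t) (x y : ℝ) :
    0 ≤ heatFactor a t x y := by
  have := besselSeries_nonneg ha (sq_nonneg (x * y * heatScale t))
  have := heatScale_pos ht
  rw [heatFactor]; positivity

lemma heatProd_nonneg {d : ℕ} {α : Fin d → ℝ} (hα : ∀ i, -1 < α i) {t : ℝ} (ht : 0 < t)
    (x y : Fin d → ℝ) : 0 ≤ heatProd α t x y :=
  Finset.prod_nonneg fun i _ => heatFactor_nonneg (hα i) ht _ _

lemma potentialKernel_nonneg {d : ℕ} {α : Fin d → ℝ} (hα : ∀ i, -1 < α i) {σ : ℝ} (hσ : 0 < σ)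
    (x y : Fin d → ℝ) : 0 ≤ potentialKernel α σ x y := by
  rw [potentialKernel_eq hα]
  refine mul_nonneg (inv_nonneg.2 (Real.Gamma_pos_of_pos hσ).le)
    (setIntegral_nonneg measurableSet_Ioi fun t ht => ?_)
  exact mul_nonneg (heatProd_nonneg hα ht x y) (Real.rpow_nonneg (le_of_lt ht) _)

lemma measurable_besselSeries {a : ℝ} (ha : -1 < a) : Measurable (besselSeries a) := by
  refine measurable_of_tendsto_metrizable (f := fun n w => ∑ k ∈ Finset.range n,
    w ^ k / (k.factorial * Real.Gamma (k + a + 1))) (fun n => by fun_prop) ?_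
  rw [tendsto_pi_nhds]
  exact fun w => (hasSum_besselSeries ha w).tendsto_sum_nat

lemma measurable_heatScale : Measurable heatScale := by
  unfold heatScale
  fun_prop

lemma measurable_heatFactor {a : ℝ} (ha : -1 < a) {Ω : Type*} [MeasurableSpace Ω] {t x y : Ω → ℝ}
    (ht : Measurable t) (hx : Measurable x) (hy : Measurable y) :
    Measurable fun ω => heatFactor a (t ω) (x ω) (y ω) := by
  have h1 := measurable_heatScale.comp ht
  have h2 := (measurable_besselSeries ha).comp (((hx.mul hy).mul h1).pow_const 2)
  have h3 := h1.pow_const (a + 1)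
  unfold heatFactor
  refine ((h3.const_mul 2).mul ?_).mul h2
  fun_prop

lemma measurable_heatProd {d : ℕ} {α : Fin d → ℝ} (hα : ∀ i, -1 < α i) :
    Measurable fun p : ((Fin d → ℝ) × (Fin d → ℝ)) × ℝ => heatProd α p.2 p.1.1 p.1.2 := by
  unfold heatProd
  exact Finset.measurable_prod _ fun i _ => measurable_heatFactor (hα i) (by fun_prop)
    (by fun_prop) (by fun_prop)

lemma measurable_potentialKernel {d : ℕ} {α : Fin d → ℝ} (hα : ∀ i, -1 < α i) (σ : ℝ) :
    Measurable fun p : (Fin d → ℝ) × (Fin d → ℝ) => potentialKernel α σ p.1 p.2 := by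
  simp only [potentialKernel_eq hα]
  refine Measurable.const_mul ?_ _
  have h : StronglyMeasurable fun q : ((Fin d → ℝ) × (Fin d → ℝ)) × ℝ =>
      heatProd α q.2 q.1.1 q.1.2 * q.2 ^ (σ - 1) :=
    ((measurable_heatProd hα).mul (measurable_snd.pow_const _)).stronglyMeasurable
  exact (h.integral_prod_right (ν := volume.restrict (Set.Ioi 0))).measurable

/-! ### Log-convexity in the parameter -/

/-- This is the converse, up to a constant, of the log-convexity of Gamma. By weighted AM–GM,
`(n+b)^l (n+c)^(1-l) ≤ n + lb + (1-l)c`, so the quotient of the two sides does not increase with `n`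
and `C` is its value at `n = 0`. -/
lemma Gamma_mul_rpow_le {b c l : ℝ} (hb : 0 < b) (hc : 0 < c) (hl : 0 < l) (hl1 : l < 1) :
    ∃ C > 0, ∀ n : ℕ, Real.Gamma (n + b) ^ l * Real.Gamma (n + c) ^ (1 - l) ≤
      C * Real.Gamma (n + (l * b + (1 - l) * c)) := by
  have hl' : 0 < 1 - l := by linarith
  have he : 0 < l * b + (1 - l) * c := by positivity
  set e := l * b + (1 - l) * c with hedef
  have pb := Real.Gamma_pos_of_pos hb
  have pc := Real.Gamma_pos_of_pos hc
  have pe := Real.Gamma_pos_of_pos he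
  refine ⟨Real.Gamma b ^ l * Real.Gamma c ^ (1 - l) / Real.Gamma e, by positivity, fun n => ?_⟩
  induction n with
  | zero => simp [div_mul_cancel₀ _ pe.ne']
  | succ n ih =>
    have hn : (0 : ℝ) ≤ n := n.cast_nonneg
    have step : ∀ z : ℝ, 0 < z →
        Real.Gamma ((n + 1 : ℕ) + z) = (n + z) * Real.Gamma (n + z) := by
      intro z hz
      rw [← Real.Gamma_add_one (by positivity)]
      congr 1; push_cast; ring
    have pbn : 0 < Real.Gamma (n + b) := Real.Gamma_pos_of_pos (by positivity)
    have pcn : 0 < Real.Gamma (n + c) := Real.Gamma_pos_of_pos (by positivity)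
    rw [step b hb, step c hc, step e he, Real.mul_rpow (by positivity) pbn.le,
      Real.mul_rpow (by positivity) pcn.le]
    have am := Real.geom_mean_le_arith_mean2_weighted hl.le hl'.le
      (by positivity : 0 ≤ (n : ℝ) + b) (by positivity : 0 ≤ (n : ℝ) + c) (by ring)
    have e1 : l * (n + b) + (1 - l) * (n + c) = n + e := by rw [hedef]; ring
    rw [e1] at am
    calc _ = ((n + b) ^ l * (n + c) ^ (1 - l)) *
          (Real.Gamma (n + b) ^ l * Real.Gamma (n + c) ^ (1 - l)) := by ring
      _ ≤ (n + e) * (Real.Gamma b ^ l * Real.Gamma c ^ (1 - l) / Real.Gamma e *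
          Real.Gamma (n + e)) := by gcongr
      _ = _ := by ring

/-- No condition on `l` is needed: at `z = 0` the exponents `l` and `1 - l` cannot both vanish, so
the convention `0^0 = 1` does no harm. -/
lemma rpow_mul_rpow_one_sub {z l : ℝ} (hz : 0 ≤ z) : z ^ l * z ^ (1 - l) = z := by
  rcases hz.eq_or_lt with rfl | hz
  · by_cases h : l = 0
    · simp [h]
    · simp [Real.zero_rpow h]
  · rw [← Real.rpow_add hz]; simp

/-- Termwise comparison by `Gamma_mul_rpow_le`, then Hölder for series with exponents `1/l` and
`1/(1-l)`. -/
lemma besselSeries_le {b c l : ℝ} (hb : -1 < b) (hc : -1 < c) (hl : 0 < l) (hl1 : l < 1) :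
    ∃ C > 0, ∀ w, 0 ≤ w → besselSeries (l * b + (1 - l) * c) w ≤
      C * (besselSeries b w ^ l * besselSeries c w ^ (1 - l)) := by
  have hl' : 0 < 1 - l := by linarith
  obtain ⟨C, hC, h⟩ := Gamma_mul_rpow_le (b := b + 1) (c := c + 1) (by linarith) (by linarith)
    hl hl1
  have he : -1 < l * b + (1 - l) * c := by nlinarith
  set e := l * b + (1 - l) * c with hedef
  have hee : l * (b + 1) + (1 - l) * (c + 1) = e + 1 := by rw [hedef]; ring
  rw [hee] at h
  refine ⟨C, hC, fun w hw => ?_⟩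
  set tb : ℕ → ℝ := fun k => w ^ k / (k.factorial * Real.Gamma (k + b + 1)) with htb
  set tc : ℕ → ℝ := fun k => w ^ k / (k.factorial * Real.Gamma (k + c + 1)) with htc
  have pb : ∀ k, 0 ≤ tb k := fun k => by
    have := Gamma_nat_add_pos hb k; simp only [htb]; positivity
  have pc : ∀ k, 0 ≤ tc k := fun k => by
    have := Gamma_nat_add_pos hc k; simp only [htc]; positivity
  have hpq : (1 / l).HolderConjugate (1 / (1 - l)) := by
    rw [Real.holderConjugate_iff]
    refine ⟨by rw [lt_div_iff₀ hl]; linarith, by simp⟩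
  have eb : ∀ k, (tb k ^ l) ^ (1 / l) = tb k := fun k => by
    rw [← Real.rpow_mul (pb k), mul_one_div_cancel hl.ne', Real.rpow_one]
  have ec : ∀ k, (tc k ^ (1 - l)) ^ (1 / (1 - l)) = tc k := fun k => by
    rw [← Real.rpow_mul (pc k), mul_one_div_cancel hl'.ne', Real.rpow_one]
  have H := Real.summable_and_inner_le_Lp_mul_Lq_tsum_of_nonneg hpq
    (f := fun k => tb k ^ l) (g := fun k => tc k ^ (1 - l))
    (fun k => Real.rpow_nonneg (pb k) _) (fun k => Real.rpow_nonneg (pc k) _)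
    (by simpa only [eb] using (hasSum_besselSeries hb w).summable)
    (by simpa only [ec] using (hasSum_besselSeries hc w).summable)
  simp only [eb, ec, one_div_one_div] at H
  calc besselSeries e w ≤ ∑' k, C * (tb k ^ l * tc k ^ (1 - l)) := by
        refine (hasSum_besselSeries he w).summable.tsum_le_tsum (fun k => ?_) (H.1.mul_left C)
        have hk := h k
        have gb := Gamma_nat_add_pos hb k
        have gc := Gamma_nat_add_pos hc k
        have ge := Gamma_nat_add_pos he k
        rw [← add_assoc, ← add_assoc, ← add_assoc] at hk
        have e1 : ∀ z : ℝ, 0 < z → w ^ k / (k.factorial * z) = w ^ k / k.factorial * z⁻¹ :=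
          fun z hz => by field_simp
        have p0 : 0 ≤ w ^ k / k.factorial := by positivity
        simp only [htb, htc]
        rw [e1 _ gb, e1 _ gc, e1 _ ge, Real.mul_rpow p0 (by positivity),
          Real.mul_rpow p0 (by positivity), mul_mul_mul_comm, rpow_mul_rpow_one_sub p0,
          Real.inv_rpow gb.le, Real.inv_rpow gc.le, mul_left_comm, ← mul_inv]
        gcongr
        rw [inv_le_iff_one_le_mul₀ ge]
        have : 0 < Real.Gamma (k + b + 1) ^ l * Real.Gamma (k + c + 1) ^ (1 - l) := by positivity
        rw [mul_assoc, inv_mul_eq_div, ← mul_div_assoc, one_le_div this]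
        exact hk
    _ ≤ _ := by
        rw [tsum_mul_left]
        gcongr
        exact H.2

/-- Only the Bessel series costs a constant. That the constant is uniform in `t`, `x`, `y` is what
allows integration afterwards. -/
lemma heatFactor_le {b c l : ℝ} (hb : -1 < b) (hc : -1 < c) (hl : 0 < l) (hl1 : l < 1) :
    ∃ C > 0, ∀ t x y, 0 < t → heatFactor (l * b + (1 - l) * c) t x y ≤
      C * (heatFactor b t x y ^ l * heatFactor c t x y ^ (1 - l)) := by
  obtain ⟨C, hC, h⟩ := besselSeries_le hb hc hl hl1
  refine ⟨C, hC, fun t x y ht => ?_⟩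
  have hs := heatScale_pos ht
  have hw := sq_nonneg (x * y * heatScale t)
  have p1 := besselSeries_nonneg hb hw
  have p2 := besselSeries_nonneg hc hw
  have h' := h _ hw
  simp only [heatFactor]
  set E := Real.exp (-(x ^ 2 + y ^ 2) * (1 / 2 + Real.exp (-4 * t) / (1 - Real.exp (-4 * t))))
  have hE : 0 < E := Real.exp_pos _
  set s := heatScale t
  rw [Real.mul_rpow (by positivity) p1, Real.mul_rpow (by positivity) p2,
    Real.mul_rpow (by positivity) hE.le, Real.mul_rpow (by positivity) hE.le,
    Real.mul_rpow zero_le_two (by positivity), Real.mul_rpow zero_le_two (by positivity),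
    ← Real.rpow_mul hs.le, ← Real.rpow_mul hs.le]
  have e1 : s ^ (l * b + (1 - l) * c + 1) = s ^ ((b + 1) * l) * s ^ ((c + 1) * (1 - l)) := by
    rw [← Real.rpow_add hs]; congr 1; ring
  have e2 := rpow_mul_rpow_one_sub (l := l) zero_le_two
  have e3 := rpow_mul_rpow_one_sub (l := l) hE.le
  calc _ ≤ 2 * s ^ (l * b + (1 - l) * c + 1) * E *
        (C * (besselSeries b ((x * y * s) ^ 2) ^ l * besselSeries c ((x * y * s) ^ 2) ^ (1 - l))) := by
        gcongr
    _ = ((2 : ℝ) ^ l * 2 ^ (1 - l)) * s ^ (l * b + (1 - l) * c + 1) * (E ^ l * E ^ (1 - l)) *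
        (C * (besselSeries b ((x * y * s) ^ 2) ^ l *
          besselSeries c ((x * y * s) ^ 2) ^ (1 - l))) := by rw [e2, e3]
    _ = _ := by rw [e1]; ring

lemma heatProd_le {d : ℕ} {β γ α : Fin d → ℝ} {l : ℝ} (hβ : ∀ i, -1 < β i) (hγ : ∀ i, -1 < γ i)
    (hl : 0 < l) (hl1 : l < 1) (hα : ∀ i, α i = l * β i + (1 - l) * γ i) :
    ∃ C > 0, ∀ t x y, 0 < t → heatProd α t x y ≤
      C * (heatProd β t x y ^ l * heatProd γ t x y ^ (1 - l)) := by
  choose C hC h using fun i => heatFactor_le (hβ i) (hγ i) hl hl1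
  refine ⟨∏ i, C i, Finset.prod_pos fun i _ => hC i, fun t x y ht => ?_⟩
  have pb := fun i => heatFactor_nonneg (hβ i) ht (x i) (y i)
  have pc := fun i => heatFactor_nonneg (hγ i) ht (x i) (y i)
  have hα' : ∀ i, -1 < α i := fun i => by rw [hα]; nlinarith [hβ i, hγ i]
  rw [heatProd, heatProd, heatProd, ← Real.finsetProd_rpow _ _ (fun i _ => pb i),
    ← Real.finsetProd_rpow _ _ (fun i _ => pc i), ← Finset.prod_mul_distrib,
    ← Finset.prod_mul_distrib]
  refine Finset.prod_le_prod (fun i _ => heatFactor_nonneg (hα' i) ht _ _) (fun i _ => ?_)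
  rw [hα]
  exact h i t _ _ ht

/-! ### Convergence of the potential kernel off the diagonals -/

lemma factorial_two_mul_le (k : ℕ) :
    ((2 * k).factorial : ℝ) ≤ 4 ^ k * (k.factorial * k.factorial) := by
  have h := Nat.add_choose_mul_factorial_mul_factorial k k
  rw [← two_mul] at h
  have h2 := Nat.choose_le_two_pow (2 * k) k
  rw [pow_mul] at h2
  have : (2 * k).factorial ≤ 4 ^ k * (k.factorial * k.factorial) := by
    rw [← h, mul_assoc]
    exact Nat.mul_le_mul_right _ h2
  exact_mod_cast this

/-- Since `(2k)! ≤ 4^k k!²`, the series is compared with that of `cosh(2(1+η)z)`. The slack `η`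
absorbs, by Bernoulli, the factor `k+1` from `inv_Gamma_le`. -/
lemma besselSeries_le_exp {a η : ℝ} (ha : -1 < a) (hη : 0 < η) :
    ∃ C > 0, ∀ z, 0 ≤ z → besselSeries a (z ^ 2) ≤ C * Real.exp (2 * (1 + η) * z) := by
  obtain ⟨C, hC, h⟩ := inv_Gamma_le ha
  refine ⟨C * (1 + 1 / η), by positivity, fun z hz => ?_⟩
  have hcosh := Real.hasSum_cosh (2 * (1 + η) * z)
  calc besselSeries a (z ^ 2)
      ≤ ∑' k : ℕ, C * (1 + 1 / η) * ((2 * (1 + η) * z) ^ (2 * k) / (2 * k).factorial) := by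
        refine (hasSum_besselSeries ha _).summable.tsum_le_tsum (fun k => ?_)
          (hcosh.summable.mul_left _)
        have hG := Gamma_nat_add_pos ha k
        have hb := one_add_mul_le_pow (by linarith : -2 ≤ η) (2 * k)
        have hk : (0 : ℝ) ≤ k := k.cast_nonneg
        have h1 : (k : ℝ) + 1 ≤ (1 + 1 / η) * (1 + η) ^ (2 * k) := by
          calc (k : ℝ) + 1 ≤ (1 + 1 / η) * (1 + (2 * k : ℕ) * η) := by
                push_cast
                have : (1 + 1 / η) * (1 + 2 * k * η) = 1 + 2 * k * η + 1 / η + 2 * k := by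
                  field_simp; ring
                rw [this]
                have : 0 ≤ 2 * k * η := by positivity
                have : 0 ≤ 1 / η := by positivity
                linarith
            _ ≤ _ := by gcongr
        have h2 := factorial_two_mul_le k
        have hf : (0 : ℝ) < k.factorial := by positivity
        have hf2 : (0 : ℝ) < (2 * k).factorial := by positivity
        calc (z ^ 2) ^ k / (k.factorial * Real.Gamma (k + a + 1))
            = (z ^ 2) ^ k / k.factorial * (1 / Real.Gamma (k + a + 1)) := by field_simp
          _ ≤ (z ^ 2) ^ k / k.factorial *
              (C * (((1 + 1 / η) * (1 + η) ^ (2 * k)) / k.factorial)) := by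
              gcongr
              exact (h k).trans (by gcongr)
          _ = C * (1 + 1 / η) * (((1 + η) * z) ^ (2 * k) / (k.factorial * k.factorial)) := by
              rw [mul_pow, pow_mul z]; field_simp
          _ ≤ C * (1 + 1 / η) * (((1 + η) * z) ^ (2 * k) * 4 ^ k / (2 * k).factorial) := by
              gcongr ?_ * ?_
              rw [div_le_div_iff₀ (by positivity) hf2, mul_assoc]
              gcongr
          _ = _ := by
              rw [mul_assoc 2, mul_pow 2, pow_mul 2, show (2 : ℝ) ^ 2 = 4 by norm_num]
              ring
    _ = C * (1 + 1 / η) * Real.cosh (2 * (1 + η) * z) := by rw [tsum_mul_left, hcosh.tsum_eq]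
    _ ≤ _ := by
        gcongr
        rw [Real.cosh_eq]
        have : Real.exp (-(2 * (1 + η) * z)) ≤ Real.exp (2 * (1 + η) * z) :=
          Real.exp_le_exp.2 (by have : 0 ≤ 2 * (1 + η) * z := by positivity
                                linarith)
        linarith

lemma one_add_rpow_mul_exp_bounded {b δ : ℝ} (hb : 0 < b) (hδ : 0 < δ) :
    ∃ M > 0, ∀ s, 0 ≤ s → (1 + s) ^ b * Real.exp (-(s * δ)) ≤ M := by
  refine ⟨(b / δ) ^ b * Real.exp δ, by positivity, fun s hs => ?_⟩
  have h1 : 1 + s ≤ b / δ * Real.exp (δ * (1 + s) / b) := by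
    have := Real.add_one_le_exp (δ * (1 + s) / b)
    calc 1 + s = b / δ * (δ * (1 + s) / b) := by field_simp
      _ ≤ _ := by gcongr; linarith
  calc (1 + s) ^ b * Real.exp (-(s * δ))
      ≤ (b / δ * Real.exp (δ * (1 + s) / b)) ^ b * Real.exp (-(s * δ)) := by gcongr
    _ = (b / δ) ^ b * Real.exp δ := by
        rw [Real.mul_rpow (by positivity) (Real.exp_pos _).le, ← Real.exp_mul, mul_assoc,
          ← Real.exp_add]
        congr 2
        field_simp
        ring

lemma inv_one_sub_exp_le {t : ℝ} (ht : 0 < t) :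
    (1 - Real.exp (-4 * t))⁻¹ ≤ 1 + heatScale t := by
  have h1 : 0 < 1 - Real.exp (-4 * t) := by linarith [exp_neg_four_lt_one ht]
  rw [heatScale, inv_eq_one_div, div_le_iff₀ h1, add_mul, div_mul_cancel₀ _ h1.ne',
    exp_neg_four_eq]
  nlinarith [exp_neg_two_lt_one ht, Real.exp_pos (-2 * t)]

/-- With `ρ = exp(-2t)` the difference of the two sides is `(1-ρ)² / (2(1-ρ²))`. -/
lemma heatScale_le_half_coth {t : ℝ} (ht : 0 < t) :
    heatScale t ≤ 1 / 2 + Real.exp (-4 * t) / (1 - Real.exp (-4 * t)) := by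
  have h1 : 0 < 1 - Real.exp (-4 * t) := by linarith [exp_neg_four_lt_one ht]
  rw [heatScale, ← sub_nonneg]
  have : 1 / 2 + Real.exp (-4 * t) / (1 - Real.exp (-4 * t)) -
      Real.exp (-2 * t) / (1 - Real.exp (-4 * t)) =
      (1 - Real.exp (-2 * t)) ^ 2 / (2 * (1 - Real.exp (-4 * t))) := by
    rw [sub_sq, one_pow, ← exp_neg_four_eq]
    have h2 := h1.ne'
    generalize Real.exp (-4 * t) = E at h2 ⊢
    field_simp
    ring
  rw [this]
  positivity

lemma heatFactor_le_exp {a x y : ℝ} (ha : -1 < a) (hx : 0 < x) (hy : 0 < y) (hxy : x ≠ y) :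
    ∃ M > 0, ∀ t, 0 < t → heatFactor a t x y ≤ M * Real.exp (-2 * (a + 1) * t) := by
  have hsq : 0 < (x - y) ^ 2 := by have := sub_ne_zero.2 hxy; positivity
  -- The Gaussian and the Bessel growth together leave `exp(-s(x-y)²)`, where `s` is `heatScale t`.
  -- This `η` spends half of that exponent; the other half controls `(1+s)^(a+1)`, which blows up as
  -- `t → 0`.
  have hη : 0 < (x - y) ^ 2 / (4 * (x * y)) := by positivity
  obtain ⟨C, hC, h⟩ := besselSeries_le_exp ha hη
  obtain ⟨M, hM, hb⟩ := one_add_rpow_mul_exp_bounded (b := a + 1) (δ := (x - y) ^ 2 / 2)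
    (by linarith) (by positivity)
  refine ⟨2 * C * M, by positivity, fun t ht => ?_⟩
  have hs := heatScale_pos ht
  have h1 : 0 < 1 - Real.exp (-4 * t) := by linarith [exp_neg_four_lt_one ht]
  have hscale : heatScale t ^ (a + 1) ≤ Real.exp (-2 * (a + 1) * t) * (1 + heatScale t) ^ (a + 1) := by
    have e : Real.exp (-2 * (a + 1) * t) = Real.exp (-2 * t) ^ (a + 1) := by
      rw [← Real.exp_mul]; congr 1; ring
    rw [e, ← Real.mul_rpow (Real.exp_pos _).le (by positivity)]
    refine Real.rpow_le_rpow hs.le ?_ (by linarith)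
    nth_rw 1 [heatScale]
    rw [div_eq_mul_inv]
    gcongr
    exact inv_one_sub_exp_le ht
  have hexp : Real.exp (-(x ^ 2 + y ^ 2) *
      (1 / 2 + Real.exp (-4 * t) / (1 - Real.exp (-4 * t)))) *
      Real.exp (2 * (1 + (x - y) ^ 2 / (4 * (x * y))) * (x * y * heatScale t)) ≤
      Real.exp (-(heatScale t * ((x - y) ^ 2 / 2))) := by
    rw [← Real.exp_add, Real.exp_le_exp]
    have e : 2 * (1 + (x - y) ^ 2 / (4 * (x * y))) * (x * y * heatScale t) =
        (2 * (x * y) + (x - y) ^ 2 / 2) * heatScale t := by field_simp; ring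
    rw [e]
    have := mul_le_mul_of_nonneg_left (heatScale_le_half_coth ht)
      (by positivity : 0 ≤ x ^ 2 + y ^ 2)
    nlinarith
  have hbs := h (x * y * heatScale t) (by positivity)
  have hbs0 := besselSeries_nonneg ha (sq_nonneg (x * y * heatScale t))
  rw [heatFactor]
  calc _ ≤ 2 * (Real.exp (-2 * (a + 1) * t) * (1 + heatScale t) ^ (a + 1)) *
        Real.exp (-(x ^ 2 + y ^ 2) * (1 / 2 + Real.exp (-4 * t) / (1 - Real.exp (-4 * t)))) *
        (C * Real.exp (2 * (1 + (x - y) ^ 2 / (4 * (x * y))) * (x * y * heatScale t))) := by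
        gcongr
    _ = 2 * C * Real.exp (-2 * (a + 1) * t) * ((1 + heatScale t) ^ (a + 1) *
        (Real.exp (-(x ^ 2 + y ^ 2) * (1 / 2 + Real.exp (-4 * t) / (1 - Real.exp (-4 * t)))) *
        Real.exp (2 * (1 + (x - y) ^ 2 / (4 * (x * y))) * (x * y * heatScale t)))) := by ring
    _ ≤ 2 * C * Real.exp (-2 * (a + 1) * t) * M := by
        gcongr
        refine le_trans ?_ (hb _ hs.le)
        gcongr
    _ = _ := by ring

/-- The integrand is dominated by `t^(σ-1) exp(-ct)` with `c = 2∑(αᵢ+1)`, which is positive because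
`d ≥ 1`. Requiring all coordinates to differ excludes only a null set of `y`. -/
lemma integrableOn_heatProd {d : ℕ} (hd : 1 ≤ d) {α : Fin d → ℝ} (hα : ∀ i, -1 < α i) {σ : ℝ}
    (hσ : 0 < σ) {x y : Fin d → ℝ} (hx : x ∈ orthant d) (hy : y ∈ orthant d)
    (hxy : ∀ i, x i ≠ y i) :
    IntegrableOn (fun t => heatProd α t x y * t ^ (σ - 1)) (Set.Ioi 0) := by
  choose M hM h using fun i => heatFactor_le_exp (hα i) (hx i) (hy i) (hxy i)
  have : Nonempty (Fin d) := ⟨⟨0, hd⟩⟩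
  have hc : 0 < 2 * ∑ i, (α i + 1) := by
    have : 0 < ∑ i, (α i + 1) :=
      Finset.sum_pos (fun i _ => by linarith [hα i]) Finset.univ_nonempty
    linarith
  have hint := (integrableOn_rpow_mul_exp_neg_mul_rpow (p := 1) (s := σ - 1) (by linarith)
    one_pos hc).const_mul (∏ i, M i)
  have hmeas : Measurable fun t : ℝ => heatProd α t x y * t ^ (σ - 1) :=
    ((measurable_heatProd hα).comp (measurable_const.prodMk measurable_id : Measurable
      fun t : ℝ => (((x, y), t) : ((Fin d → ℝ) × (Fin d → ℝ)) × ℝ))).mul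
      (measurable_id.pow_const _)
  refine Integrable.mono' hint hmeas.aestronglyMeasurable ?_
  refine (ae_restrict_iff' measurableSet_Ioi).2 (ae_of_all _ fun t (ht : 0 < t) => ?_)
  have hp := heatProd_nonneg hα ht x y
  rw [Real.norm_of_nonneg (by positivity), Real.rpow_one]
  have hle : heatProd α t x y ≤ (∏ i, M i) * Real.exp (-(2 * ∑ i, (α i + 1)) * t) := by
    have e : Real.exp (-(2 * ∑ i, (α i + 1)) * t) = ∏ i, Real.exp (-2 * (α i + 1) * t) := by
      rw [← Real.exp_sum, ← Finset.sum_mul, ← Finset.mul_sum]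
      congr 1; ring
    rw [e, ← Finset.prod_mul_distrib]
    exact Finset.prod_le_prod (fun i _ => heatFactor_nonneg (hα i) ht _ _) (fun i _ => h i t ht)
  calc heatProd α t x y * t ^ (σ - 1)
      ≤ (∏ i, M i) * Real.exp (-(2 * ∑ i, (α i + 1)) * t) * t ^ (σ - 1) := by gcongr
    _ = _ := by ring

/-- The potential kernel as a lower Lebesgue integral. -/
def potentialLKernel {d : ℕ} (α : Fin d → ℝ) (σ : ℝ) (x y : Fin d → ℝ) : ℝ≥0∞ :=
  ∫⁻ t in Set.Ioi (0 : ℝ), ENNReal.ofReal (heatProd α t x y * t ^ (σ - 1))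

/-- Valid without any convergence, because a divergent Bochner integral is 0. This direction
suffices for the kernel being bounded; the bounding kernels need equality. -/
lemma ofReal_potentialKernel_le {d : ℕ} {α : Fin d → ℝ} (hα : ∀ i, -1 < α i) {σ : ℝ}
    (hσ : 0 < σ) (x y : Fin d → ℝ) : ENNReal.ofReal (potentialKernel α σ x y) ≤
      ENNReal.ofReal (Real.Gamma σ)⁻¹ * potentialLKernel α σ x y := by
  have hG : 0 ≤ (Real.Gamma σ)⁻¹ := inv_nonneg.2 (Real.Gamma_pos_of_pos hσ).le
  rw [potentialKernel_eq hα, ENNReal.ofReal_mul hG]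
  gcongr
  by_cases hi : IntegrableOn (fun t => heatProd α t x y * t ^ (σ - 1)) (Set.Ioi 0)
  · rw [ofReal_integral_eq_lintegral_ofReal hi]
    · rfl
    · exact (ae_restrict_iff' measurableSet_Ioi).2 (ae_of_all _ fun t (ht : 0 < t) =>
        mul_nonneg (heatProd_nonneg hα ht x y) (Real.rpow_nonneg ht.le _))
  · rw [integral_undef hi]
    simp

lemma ofReal_potentialKernel_eq {d : ℕ} (hd : 1 ≤ d) {α : Fin d → ℝ} (hα : ∀ i, -1 < α i) {σ : ℝ}
    (hσ : 0 < σ) {x y : Fin d → ℝ} (hx : x ∈ orthant d) (hy : y ∈ orthant d)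
    (hxy : ∀ i, x i ≠ y i) : ENNReal.ofReal (potentialKernel α σ x y) =
      ENNReal.ofReal (Real.Gamma σ)⁻¹ * potentialLKernel α σ x y := by
  have hG : 0 ≤ (Real.Gamma σ)⁻¹ := inv_nonneg.2 (Real.Gamma_pos_of_pos hσ).le
  rw [potentialKernel_eq hα, ENNReal.ofReal_mul hG,
    ofReal_integral_eq_lintegral_ofReal (integrableOn_heatProd hd hα hσ hx hy hxy)]
  · rfl
  · exact (ae_restrict_iff' measurableSet_Ioi).2 (ae_of_all _ fun t (ht : 0 < t) =>
      mul_nonneg (heatProd_nonneg hα ht x y) (Real.rpow_nonneg ht.le _))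

/-- Log-convexity of the potential kernel in the parameters, up to a constant. -/
lemma potentialKernel_le {d : ℕ} (hd : 1 ≤ d) {β γ α : Fin d → ℝ} {l σ₁ σ₂ σ : ℝ}
    (hβ : ∀ i, -1 < β i) (hγ : ∀ i, -1 < γ i) (hl : 0 < l) (hl1 : l < 1)
    (hα : ∀ i, α i = l * β i + (1 - l) * γ i) (hσ₁ : 0 < σ₁) (hσ₂ : 0 < σ₂)
    (hσ : σ = l * σ₁ + (1 - l) * σ₂) :
    ∃ C : ℝ≥0, ∀ x ∈ orthant d, ∀ y ∈ orthant d, (∀ i, x i ≠ y i) →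
      ENNReal.ofReal (potentialKernel α σ x y) ≤
        C * (ENNReal.ofReal (potentialKernel β σ₁ x y) ^ l *
          ENNReal.ofReal (potentialKernel γ σ₂ x y) ^ (1 - l)) := by
  have hl' : 0 < 1 - l := by linarith
  have hα' : ∀ i, -1 < α i := fun i => by rw [hα]; nlinarith [hβ i, hγ i]
  have hσ0 : 0 < σ := by rw [hσ]; positivity
  obtain ⟨C, hC, h⟩ := heatProd_le hβ hγ hl hl1 hα
  have g0 := Real.Gamma_pos_of_pos hσ0
  have g1 := Real.Gamma_pos_of_pos hσ₁
  have g2 := Real.Gamma_pos_of_pos hσ₂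
  -- The powers of `Γ(σ₁)` and `Γ(σ₂)` cancel the normalisations of the two bounding kernels.
  refine ⟨Real.toNNReal ((Real.Gamma σ)⁻¹ * C *
    (Real.Gamma σ₁ ^ l * Real.Gamma σ₂ ^ (1 - l))), fun x hx y hy hxy => ?_⟩
  rw [ofReal_potentialKernel_eq hd hβ hσ₁ hx hy hxy, ofReal_potentialKernel_eq hd hγ hσ₂ hx hy hxy]
  refine (ofReal_potentialKernel_le hα' hσ0 x y).trans ?_
  have hm : ∀ {δ : Fin d → ℝ} (_ : ∀ i, -1 < δ i) (τ : ℝ), Measurable fun t : ℝ =>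
      ENNReal.ofReal (heatProd δ t x y * t ^ (τ - 1)) := fun hδ τ =>
    (((measurable_heatProd hδ).comp (measurable_const.prodMk measurable_id : Measurable
      fun t : ℝ => (((x, y), t) : ((Fin d → ℝ) × (Fin d → ℝ)) × ℝ))).mul
      (measurable_id.pow_const _)).ennreal_ofReal
  -- Hölder in `t`; the power splits because `σ - 1 = l(σ₁-1) + (1-l)(σ₂-1)`.
  have key : potentialLKernel α σ x y ≤ ENNReal.ofReal C *
      (potentialLKernel β σ₁ x y ^ l * potentialLKernel γ σ₂ x y ^ (1 - l)) := by
    refine le_trans ?_ (mul_le_mul_right (ENNReal.lintegral_mul_norm_pow_le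
      (hm hβ σ₁).aemeasurable (hm hγ σ₂).aemeasurable hl.le hl'.le (by ring)) _)
    rw [← lintegral_const_mul' _ _ ENNReal.ofReal_ne_top]
    refine setLIntegral_mono' measurableSet_Ioi fun t (ht : 0 < t) => ?_
    have p1 := heatProd_nonneg hβ ht x y
    have p2 := heatProd_nonneg hγ ht x y
    rw [ENNReal.ofReal_rpow_of_nonneg (by positivity) hl.le,
      ENNReal.ofReal_rpow_of_nonneg (by positivity) hl'.le, ← ENNReal.ofReal_mul (by positivity),
      ← ENNReal.ofReal_mul hC.le]
    refine ENNReal.ofReal_le_ofReal ?_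
    rw [Real.mul_rpow p1 (by positivity), Real.mul_rpow p2 (by positivity), ← Real.rpow_mul ht.le,
      ← Real.rpow_mul ht.le]
    have e : t ^ (σ - 1) = t ^ ((σ₁ - 1) * l) * t ^ ((σ₂ - 1) * (1 - l)) := by
      rw [← Real.rpow_add ht, hσ]; congr 1; ring
    calc _ ≤ C * (heatProd β t x y ^ l * heatProd γ t x y ^ (1 - l)) * t ^ (σ - 1) := by
          gcongr
          exact h t x y ht
      _ = _ := by rw [e]; ring
  have gg : ∀ {z : ℝ} (m : ℝ), 0 < z → 0 ≤ m →
      ENNReal.ofReal (z ^ m) * ENNReal.ofReal z⁻¹ ^ m = 1 := by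
    intro z m hz hm
    rw [ENNReal.ofReal_rpow_of_nonneg (by positivity) hm, ← ENNReal.ofReal_mul (by positivity),
      Real.inv_rpow hz.le, mul_inv_cancel₀ (by positivity), ENNReal.ofReal_one]
  calc _ ≤ ENNReal.ofReal (Real.Gamma σ)⁻¹ * (ENNReal.ofReal C *
      (potentialLKernel β σ₁ x y ^ l * potentialLKernel γ σ₂ x y ^ (1 - l))) := by gcongr
    _ = ENNReal.ofReal (Real.Gamma σ)⁻¹ * ENNReal.ofReal C *
        ((ENNReal.ofReal (Real.Gamma σ₁ ^ l) * ENNReal.ofReal (Real.Gamma σ₁)⁻¹ ^ l) *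
        (ENNReal.ofReal (Real.Gamma σ₂ ^ (1 - l)) * ENNReal.ofReal (Real.Gamma σ₂)⁻¹ ^ (1 - l))) *
        (potentialLKernel β σ₁ x y ^ l * potentialLKernel γ σ₂ x y ^ (1 - l)) := by
        rw [gg l g1 hl.le, gg (1 - l) g2 hl'.le]; ring
    _ = _ := by
        rw [ENNReal.mul_rpow_of_nonneg _ _ hl.le, ENNReal.mul_rpow_of_nonneg _ _ hl'.le,
          ← ENNReal.ofReal, ENNReal.ofReal_mul (by positivity), ENNReal.ofReal_mul (by positivity),
          ENNReal.ofReal_mul (by positivity)]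
        ring

/-! ### The weighted measures -/

lemma measurableSet_orthant (d : ℕ) : MeasurableSet (orthant d) := by
  have : orthant d = Set.univ.pi fun _ => Set.Ioi 0 := by ext x; simp [orthant]
  rw [this]
  exact MeasurableSet.univ_pi fun _ => measurableSet_Ioi

lemma ae_mem_orthant (d : ℕ) : ∀ᵐ x ∂(orthantVolume d), x ∈ orthant d :=
  ae_restrict_mem (measurableSet_orthant d)

lemma ae_coord_ne {d : ℕ} (x : Fin d → ℝ) : ∀ᵐ y ∂(orthantVolume d), ∀ i, x i ≠ y i := by
  refine ae_restrict_of_ae (ae_all_iff.2 fun i => ?_)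
  filter_upwards [Measure.ae_eval_ne (fun _ : Fin d => (volume : Measure ℝ)) i (x i)] with y hy
  exact hy.symm

/-- The Lebesgue density of `mu α`. -/
def muDensity {d : ℕ} (α x : Fin d → ℝ) : ℝ := ∏ i, x i ^ (2 * α i + 1)

lemma muDensity_pos {d : ℕ} (α : Fin d → ℝ) {x : Fin d → ℝ} (hx : x ∈ orthant d) :
    0 < muDensity α x :=
  Finset.prod_pos fun i _ => Real.rpow_pos_of_pos (hx i) _

lemma measurable_muDensity {d : ℕ} (α : Fin d → ℝ) : Measurable (muDensity α) :=
  Finset.measurable_prod _ fun i _ => (measurable_pi_apply i).pow_const _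

lemma muDensity_interpolate {d : ℕ} {β γ α : Fin d → ℝ} {l : ℝ}
    (hα : ∀ i, α i = l * β i + (1 - l) * γ i) {x : Fin d → ℝ} (hx : x ∈ orthant d) :
    muDensity α x = muDensity β x ^ l * muDensity γ x ^ (1 - l) := by
  rw [muDensity, muDensity, muDensity,
    ← Real.finsetProd_rpow _ _ (fun i _ => Real.rpow_nonneg (hx i).le _),
    ← Real.finsetProd_rpow _ _ (fun i _ => Real.rpow_nonneg (hx i).le _),
    ← Finset.prod_mul_distrib]
  refine Finset.prod_congr rfl fun i _ => ?_
  rw [← Real.rpow_mul (hx i).le, ← Real.rpow_mul (hx i).le, ← Real.rpow_add (hx i), hα]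
  congr 1; ring

lemma lintegral_mu {d : ℕ} (α : Fin d → ℝ) {g : (Fin d → ℝ) → ℝ≥0∞}
    (hg : AEMeasurable g (orthantVolume d)) :
    ∫⁻ x, g x ∂(mu α) = ∫⁻ x, ENNReal.ofReal (muDensity α x) * g x ∂(orthantVolume d) :=
  lintegral_withDensity_eq_lintegral_mul₀ (measurable_muDensity α).ennreal_ofReal.aemeasurable hg

lemma mu_ac {d : ℕ} (α : Fin d → ℝ) : mu α ≪ orthantVolume d :=
  withDensity_absolutelyContinuous _ _

lemma ac_mu {d : ℕ} (α : Fin d → ℝ) : orthantVolume d ≪ mu α := by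
  refine withDensity_absolutelyContinuous' (measurable_muDensity α).ennreal_ofReal.aemeasurable ?_
  filter_upwards [ae_mem_orthant d] with x hx
  exact (ENNReal.ofReal_pos.2 (muDensity_pos α hx)).ne'

instance {d : ℕ} (α : Fin d → ℝ) : SFinite (mu α) := by
  unfold mu orthantVolume
  infer_instance

lemma weightedMu_ac {d : ℕ} (w : (Fin d → ℝ) → ℝ) (α : Fin d → ℝ) :
    weightedMu w α ≪ orthantVolume d :=
  (withDensity_absolutelyContinuous _ _).trans (mu_ac α)

/-- Positivity of the weight almost everywhere brings measurability of `f` back from the weighted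
measure to Lebesgue measure. -/
lemma ac_weightedMu {d : ℕ} {w : (Fin d → ℝ) → ℝ} (hw : IsPosWeight w) (α : Fin d → ℝ) :
    orthantVolume d ≪ weightedMu w α := by
  refine (ac_mu α).trans (withDensity_absolutelyContinuous' (hw.1.ennreal_ofReal.mono_ac (mu_ac α))
    ((mu_ac α).ae_le ?_))
  filter_upwards [hw.2] with x hx
  simpa using hx

lemma lintegral_weightedMu {d : ℕ} {w : (Fin d → ℝ) → ℝ} (hw : IsPosWeight w) (α : Fin d → ℝ)
    {g : (Fin d → ℝ) → ℝ≥0∞} (hg : AEMeasurable g (orthantVolume d)) :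
    ∫⁻ x, g x ∂(weightedMu w α) =
      ∫⁻ x, ENNReal.ofReal (muDensity α x * w x) * g x ∂(orthantVolume d) := by
  have hw' := hw.1.ennreal_ofReal
  rw [weightedMu, lintegral_withDensity_eq_lintegral_mul₀ (hw'.mono_ac (mu_ac α))
    (hg.mono_ac (mu_ac α))]
  rw [lintegral_mu α (hw'.mul hg)]
  refine lintegral_congr_ae ?_
  filter_upwards [ae_mem_orthant d] with x hx
  rw [Pi.mul_apply, ENNReal.ofReal_mul (muDensity_pos α hx).le, mul_assoc]

lemma isPosWeight_interpolate {d : ℕ} {w₁ w₂ w : (Fin d → ℝ) → ℝ} {l : ℝ} (h₁ : IsPosWeight w₁)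
    (h₂ : IsPosWeight w₂) (h : ∀ x, w x = w₁ x ^ l * w₂ x ^ (1 - l)) : IsPosWeight w := by
  rw [show w = fun x => w₁ x ^ l * w₂ x ^ (1 - l) from funext h]
  refine ⟨(h₁.1.pow_const l).mul (h₂.1.pow_const (1 - l)), ?_⟩
  filter_upwards [h₁.2, h₂.2] with x p₁ p₂
  positivity

lemma muDensity_mul_weight_interpolate {d : ℕ} {β γ α : Fin d → ℝ} {w₁ w₂ w : (Fin d → ℝ) → ℝ}
    {l : ℝ} (hα : ∀ i, α i = l * β i + (1 - l) * γ i)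
    (h : ∀ x, w x = w₁ x ^ l * w₂ x ^ (1 - l)) {x : Fin d → ℝ} (hx : x ∈ orthant d)
    (h₁ : 0 < w₁ x) (h₂ : 0 < w₂ x) :
    muDensity α x * w x = (muDensity β x * w₁ x) ^ l * (muDensity γ x * w₂ x) ^ (1 - l) := by
  have p1 := muDensity_pos β hx
  have p2 := muDensity_pos γ hx
  rw [muDensity_interpolate hα hx, h, Real.mul_rpow p1.le h₁.le, Real.mul_rpow p2.le h₂.le]
  ring

/-! ### The potential operator -/

lemma aestronglyMeasurable_potential {d : ℕ} {α : Fin d → ℝ} (hα : ∀ i, -1 < α i) (σ : ℝ)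
    {f : (Fin d → ℝ) → ℂ} (hf : AEStronglyMeasurable f (orthantVolume d))
    (μ : Measure (Fin d → ℝ)) : AEStronglyMeasurable (potential α σ f) μ := by
  have hf' := hf.mono_ac (mu_ac α)
  -- The integral ignores null sets in `y`, so this is equality at every `x`, and the conclusion
  -- holds for an arbitrary `μ`.
  have e : potential α σ f = potential α σ (hf'.mk f) := by
    ext x
    refine integral_congr_ae ?_
    filter_upwards [hf'.ae_eq_mk] with y hy
    rw [hy]
  rw [e]
  have h : StronglyMeasurable (Function.uncurry fun x y =>
      (potentialKernel α σ x y : ℂ) * hf'.mk f y) :=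
    (Complex.measurable_ofReal.comp (measurable_potentialKernel hα σ)).stronglyMeasurable.mul
      (hf'.stronglyMeasurable_mk.comp_measurable measurable_snd)
  exact (h.integral_prod_right (ν := mu α)).aestronglyMeasurable

lemma aestronglyMeasurable_kernel_mul {d : ℕ} {α : Fin d → ℝ} (hα : ∀ i, -1 < α i) (σ : ℝ)
    {f : (Fin d → ℝ) → ℂ} (hf : AEStronglyMeasurable f (orthantVolume d)) (x : Fin d → ℝ) :
    AEStronglyMeasurable (fun y => (potentialKernel α σ x y : ℂ) * f y) (orthantVolume d) :=
  (Complex.measurable_ofReal.comp ((measurable_potentialKernel hα σ).comp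
    (measurable_const.prodMk measurable_id))).aestronglyMeasurable.mul hf

/-- The potential of `|f|` as a lower Lebesgue integral. -/
def lpotential {d : ℕ} (α : Fin d → ℝ) (σ : ℝ) (f : (Fin d → ℝ) → ℂ) (x : Fin d → ℝ) : ℝ≥0∞ :=
  ∫⁻ y, ENNReal.ofReal (muDensity α y) * (ENNReal.ofReal (potentialKernel α σ x y) * ‖f y‖ₑ)
    ∂(orthantVolume d)

lemma lintegral_kernel_mul_eq_lpotential {d : ℕ} {α : Fin d → ℝ} (hα : ∀ i, -1 < α i) {σ : ℝ}
    (hσ : 0 < σ) {f : (Fin d → ℝ) → ℂ} (hf : AEStronglyMeasurable f (orthantVolume d))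
    (x : Fin d → ℝ) :
    ∫⁻ y, ‖(potentialKernel α σ x y : ℂ) * f y‖ₑ ∂(mu α) = lpotential α σ f x := by
  rw [lintegral_mu α (aestronglyMeasurable_kernel_mul hα σ hf x).enorm, lpotential]
  refine lintegral_congr fun y => ?_
  rw [enorm_mul, ← ofReal_norm (potentialKernel α σ x y : ℂ), Complex.norm_real,
    Real.norm_of_nonneg (potentialKernel_nonneg hα hσ x y)]

/-- There is no cancellation for nonnegative `g`. This turns the assumed bounds, stated for Bochner
integrals, into bounds for `lpotential`; integrability is needed to exclude the default value 0. -/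
lemma enorm_potential_eq_lpotential {d : ℕ} {α : Fin d → ℝ} (hα : ∀ i, -1 < α i) {σ : ℝ}
    (hσ : 0 < σ) {g : (Fin d → ℝ) → ℝ} (hg : AEStronglyMeasurable g (orthantVolume d))
    (hg0 : ∀ y, 0 ≤ g y) {x : Fin d → ℝ}
    (hx : Integrable (fun y => (potentialKernel α σ x y : ℂ) * (g y : ℂ)) (mu α)) :
    ‖potential α σ (fun y => (g y : ℂ)) x‖ₑ = lpotential α σ (fun y => (g y : ℂ)) x := by
  have hgc : AEStronglyMeasurable (fun y => (g y : ℂ)) (orthantVolume d) :=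
    Complex.continuous_ofReal.comp_aestronglyMeasurable hg
  rw [← lintegral_kernel_mul_eq_lpotential hα hσ hgc, potential]
  simp only [← Complex.ofReal_mul] at hx ⊢
  have hp : ∀ y, 0 ≤ potentialKernel α σ x y * g y := fun y =>
    mul_nonneg (potentialKernel_nonneg hα hσ x y) (hg0 y)
  have hr : Integrable (fun y => potentialKernel α σ x y * g y) (mu α) := by
    simpa using hx.re
  rw [integral_complex_ofReal, ← ofReal_norm, Complex.norm_real,
    Real.norm_of_nonneg (integral_nonneg hp), ofReal_integral_eq_lintegral_ofReal hr (ae_of_all _ hp)]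
  refine lintegral_congr fun y => ?_
  rw [← ofReal_norm, Complex.norm_real, Real.norm_of_nonneg (hp y)]

/-- Hölder's inequality for the potentials. -/
lemma lpotential_le {d : ℕ} (hd : 1 ≤ d) {β γ α : Fin d → ℝ} {l σ₁ σ₂ σ : ℝ}
    (hβ : ∀ i, -1 < β i) (hγ : ∀ i, -1 < γ i) (hl : 0 < l) (hl1 : l < 1)
    (hα : ∀ i, α i = l * β i + (1 - l) * γ i) (hσ₁ : 0 < σ₁) (hσ₂ : 0 < σ₂)
    (hσ : σ = l * σ₁ + (1 - l) * σ₂) :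
    ∃ C : ℝ≥0, ∀ f f₁ f₂ : (Fin d → ℝ) → ℂ, AEStronglyMeasurable f₁ (orthantVolume d) →
      AEStronglyMeasurable f₂ (orthantVolume d) →
      (∀ᵐ y ∂(orthantVolume d), ‖f y‖ₑ = ‖f₁ y‖ₑ ^ l * ‖f₂ y‖ₑ ^ (1 - l)) →
      ∀ x ∈ orthant d, lpotential α σ f x ≤
        C * (lpotential β σ₁ f₁ x ^ l * lpotential γ σ₂ f₂ x ^ (1 - l)) := by
  have hl' : 0 < 1 - l := by linarith
  obtain ⟨C, hC⟩ := potentialKernel_le hd hβ hγ hl hl1 hα hσ₁ hσ₂ hσ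
  refine ⟨C, fun f f₁ f₂ hf₁ hf₂ hf x hx => ?_⟩
  have hm : ∀ {δ : Fin d → ℝ} (_ : ∀ i, -1 < δ i) (τ : ℝ) {g : (Fin d → ℝ) → ℂ}
      (_ : AEStronglyMeasurable g (orthantVolume d)), AEMeasurable (fun y =>
        ENNReal.ofReal (muDensity δ y) * (ENNReal.ofReal (potentialKernel δ τ x y) * ‖g y‖ₑ))
        (orthantVolume d) := fun {δ} hδ τ g hg =>
    (measurable_muDensity δ).ennreal_ofReal.aemeasurable.mul
      ((((measurable_potentialKernel hδ τ).comp
        (measurable_const.prodMk measurable_id)).ennreal_ofReal.aemeasurable).mul hg.enorm)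
  refine le_trans ?_ (mul_le_mul_right (ENNReal.lintegral_mul_norm_pow_le
      (hm hβ σ₁ hf₁) (hm hγ σ₂ hf₂) hl.le hl'.le (by ring)) _)
  rw [← lintegral_const_mul' _ _ ENNReal.coe_ne_top, lpotential]
  refine lintegral_mono_ae ?_
  filter_upwards [hf, ae_mem_orthant d, ae_coord_ne x] with y hy hyo hxy
  have p1 := muDensity_pos β hyo
  have p2 := muDensity_pos γ hyo
  rw [hy, muDensity_interpolate hα hyo, ENNReal.ofReal_mul (by positivity),
    ← ENNReal.ofReal_rpow_of_nonneg p1.le hl.le, ← ENNReal.ofReal_rpow_of_nonneg p2.le hl'.le]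
  simp only [ENNReal.mul_rpow_of_nonneg _ _ hl.le, ENNReal.mul_rpow_of_nonneg _ _ hl'.le]
  refine le_trans (mul_le_mul_right (mul_le_mul_left (hC x hx y hyo hxy) _) _) (le_of_eq ?_)
  ring

/-! ### Splitting of functions -/

/-- Splitting a function of `L^p(U)` into functions of `L^p(U₁)` and `L^p(U₂)`. -/
lemma exists_splitting {d : ℕ} {β γ α : Fin d → ℝ} {l P : ℝ} (hP : 0 < P)
    (hα : ∀ i, α i = l * β i + (1 - l) * γ i) {U₁ U₂ U : (Fin d → ℝ) → ℝ} (hU₁ : IsPosWeight U₁)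
    (hU₂ : IsPosWeight U₂) (hU : ∀ x, U x = U₁ x ^ l * U₂ x ^ (1 - l)) {f : (Fin d → ℝ) → ℂ}
    (hf : AEStronglyMeasurable f (orthantVolume d)) :
    ∃ g₁ g₂ : (Fin d → ℝ) → ℝ, AEStronglyMeasurable g₁ (orthantVolume d) ∧
      AEStronglyMeasurable g₂ (orthantVolume d) ∧ (∀ y, 0 ≤ g₁ y) ∧ (∀ y, 0 ≤ g₂ y) ∧
      ∀ᵐ y ∂(orthantVolume d), ‖f y‖ = g₁ y ^ l * g₂ y ^ (1 - l) ∧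
        muDensity β y * U₁ y * g₁ y ^ P = muDensity α y * U y * ‖f y‖ ^ P ∧
        muDensity γ y * U₂ y * g₂ y ^ P = muDensity α y * U y * ‖f y‖ ^ P := by
  set u₁ : (Fin d → ℝ) → ℝ := fun y => muDensity β y * U₁ y with hu₁
  set u₂ : (Fin d → ℝ) → ℝ := fun y => muDensity γ y * U₂ y with hu₂
  have m₁ : AEMeasurable u₁ (orthantVolume d) := (measurable_muDensity β).aemeasurable.mul hU₁.1
  have m₂ : AEMeasurable u₂ (orthantVolume d) := (measurable_muDensity γ).aemeasurable.mul hU₂.1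
  -- These exponents solve `uᵢ gᵢ^P = u₁^l u₂^(1-l) |f|^P`. The absolute values keep `gᵢ`
  -- nonnegative also on the null set where a weight may fail to be positive.
  refine ⟨fun y => ‖f y‖ * |u₂ y / u₁ y| ^ ((1 - l) / P), fun y => ‖f y‖ * |u₁ y / u₂ y| ^ (l / P),
    ?_, ?_, fun y => by positivity, fun y => by positivity, ?_⟩
  · exact hf.norm.mul ((m₂.div m₁).abs.pow_const _).aestronglyMeasurable
  · exact hf.norm.mul ((m₁.div m₂).abs.pow_const _).aestronglyMeasurable
  · filter_upwards [ae_mem_orthant d, hU₁.2, hU₂.2] with y hy h₁ h₂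
    have q₁ : 0 < u₁ y := mul_pos (muDensity_pos β hy) h₁
    have q₂ : 0 < u₂ y := mul_pos (muDensity_pos γ hy) h₂
    have hn : 0 ≤ ‖f y‖ := norm_nonneg _
    rw [muDensity_mul_weight_interpolate hα hU hy h₁ h₂, abs_of_pos (div_pos q₂ q₁),
      abs_of_pos (div_pos q₁ q₂)]
    change _ ∧ u₁ y * _ = u₁ y ^ l * u₂ y ^ (1 - l) * _ ∧ u₂ y * _ = u₁ y ^ l * u₂ y ^ (1 - l) * _
    generalize u₁ y = a at q₁ q₂ ⊢
    generalize u₂ y = b at q₁ q₂ ⊢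
    have e1 : (a / b) = (b / a)⁻¹ := by rw [inv_div]
    have hba : 0 < b / a := div_pos q₂ q₁
    refine ⟨?_, ?_, ?_⟩
    · rw [Real.mul_rpow hn (by positivity), Real.mul_rpow hn (by positivity), mul_mul_mul_comm,
        rpow_mul_rpow_one_sub hn, e1, Real.inv_rpow hba.le, Real.inv_rpow (by positivity),
        ← Real.rpow_mul hba.le, ← Real.rpow_mul hba.le, show (1 - l) / P * l = l / P * (1 - l) by ring,
        mul_inv_cancel₀ (by positivity), mul_one]
    · rw [Real.mul_rpow hn (by positivity), ← Real.rpow_mul hba.le, div_mul_cancel₀ _ hP.ne',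
        Real.div_rpow q₂.le q₁.le]
      have := rpow_mul_rpow_one_sub (l := l) q₁.le
      have h0 : 0 < a ^ (1 - l) := by positivity
      nth_rw 1 [← this]
      field_simp
    · have hab : 0 < a / b := div_pos q₁ q₂
      rw [Real.mul_rpow hn (by positivity), ← Real.rpow_mul hab.le, div_mul_cancel₀ _ hP.ne',
        Real.div_rpow q₁.le q₂.le]
      have := rpow_mul_rpow_one_sub (l := l) q₂.le
      have h0 : 0 < b ^ l := by positivity
      nth_rw 1 [← this]
      field_simp

lemma lintegral_enorm_rpow_eq {d : ℕ} {β α : Fin d → ℝ} {P : ℝ} (hP : 0 < P)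
    {U₁ U : (Fin d → ℝ) → ℝ} (hU₁ : IsPosWeight U₁) (hU : IsPosWeight U) {f : (Fin d → ℝ) → ℂ}
    (hf : AEStronglyMeasurable f (orthantVolume d)) {g : (Fin d → ℝ) → ℝ}
    (hg : AEStronglyMeasurable g (orthantVolume d)) (hg0 : ∀ y, 0 ≤ g y)
    (h : ∀ᵐ y ∂(orthantVolume d),
      muDensity β y * U₁ y * g y ^ P = muDensity α y * U y * ‖f y‖ ^ P) :
    ∫⁻ y, ‖(g y : ℂ)‖ₑ ^ P ∂(weightedMu U₁ β) = ∫⁻ y, ‖f y‖ₑ ^ P ∂(weightedMu U α) := by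
  have hgc : AEStronglyMeasurable (fun y => (g y : ℂ)) (orthantVolume d) :=
    Complex.continuous_ofReal.comp_aestronglyMeasurable hg
  rw [lintegral_weightedMu hU₁ β (hgc.enorm.pow_const P),
    lintegral_weightedMu hU α (hf.enorm.pow_const P)]
  refine lintegral_congr_ae ?_
  filter_upwards [h, ae_mem_orthant d, hU₁.2, hU.2] with y hy hyo h₁ h₂
  have q₁ := muDensity_pos β hyo
  have q₂ := muDensity_pos α hyo
  rw [← ofReal_norm (g y : ℂ), ← ofReal_norm (f y), Complex.norm_real, Real.norm_of_nonneg (hg0 y),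
    ENNReal.ofReal_rpow_of_nonneg (hg0 y) hP.le, ENNReal.ofReal_rpow_of_nonneg (norm_nonneg _) hP.le,
    ← ENNReal.ofReal_mul (by positivity), ← ENNReal.ofReal_mul (by positivity), hy]

/-! ### The convexity principle -/

/-- Weight and density of the target measure are the geometric means of the other two, so everything
merges into one Hölder inequality over Lebesgue measure. -/
lemma lintegral_enorm_rpow_le {d : ℕ} {β γ α : Fin d → ℝ} {l Q : ℝ} (hQ : 0 < Q) (hl : 0 < l)
    (hl1 : l < 1) (hα : ∀ i, α i = l * β i + (1 - l) * γ i) {V₁ V₂ V : (Fin d → ℝ) → ℝ}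
    (hV₁ : IsPosWeight V₁) (hV₂ : IsPosWeight V₂) (hV : ∀ x, V x = V₁ x ^ l * V₂ x ^ (1 - l))
    {F F₁ F₂ : (Fin d → ℝ) → ℂ} (hF : AEStronglyMeasurable F (orthantVolume d))
    (hF₁ : AEStronglyMeasurable F₁ (orthantVolume d))
    (hF₂ : AEStronglyMeasurable F₂ (orthantVolume d)) {C : ℝ≥0}
    (h : ∀ᵐ x ∂(orthantVolume d), ‖F x‖ₑ ≤ C * (‖F₁ x‖ₑ ^ l * ‖F₂ x‖ₑ ^ (1 - l))) :
    ∫⁻ x, ‖F x‖ₑ ^ Q ∂(weightedMu V α) ≤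
      (C : ℝ≥0∞) ^ Q * ((∫⁻ x, ‖F₁ x‖ₑ ^ Q ∂(weightedMu V₁ β)) ^ l *
        (∫⁻ x, ‖F₂ x‖ₑ ^ Q ∂(weightedMu V₂ γ)) ^ (1 - l)) := by
  have hl' : 0 < 1 - l := by linarith
  have m₁ := hF₁.enorm.pow_const Q
  have m₂ := hF₂.enorm.pow_const Q
  have w₁ : AEMeasurable (fun x => ENNReal.ofReal (muDensity β x * V₁ x)) (orthantVolume d) :=
    ((measurable_muDensity β).aemeasurable.mul hV₁.1).ennreal_ofReal
  have w₂ : AEMeasurable (fun x => ENNReal.ofReal (muDensity γ x * V₂ x)) (orthantVolume d) :=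
    ((measurable_muDensity γ).aemeasurable.mul hV₂.1).ennreal_ofReal
  rw [lintegral_weightedMu (isPosWeight_interpolate hV₁ hV₂ hV) α (hF.enorm.pow_const Q),
    lintegral_weightedMu hV₁ β m₁, lintegral_weightedMu hV₂ γ m₂]
  refine le_trans ?_ (mul_le_mul_right (ENNReal.lintegral_mul_norm_pow_le
    (w₁.mul m₁) (w₂.mul m₂) hl.le hl'.le (by ring)) _)
  rw [← lintegral_const_mul' _ _ (ENNReal.rpow_ne_top_of_nonneg hQ.le ENNReal.coe_ne_top)]
  refine lintegral_mono_ae ?_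
  filter_upwards [h, ae_mem_orthant d, hV₁.2, hV₂.2] with x hx hxo h₁ h₂
  have p₁ : 0 < muDensity β x * V₁ x := mul_pos (muDensity_pos β hxo) h₁
  have p₂ : 0 < muDensity γ x * V₂ x := mul_pos (muDensity_pos γ hxo) h₂
  rw [muDensity_mul_weight_interpolate hα hV hxo h₁ h₂, ENNReal.ofReal_mul (by positivity),
    ← ENNReal.ofReal_rpow_of_nonneg p₁.le hl.le, ← ENNReal.ofReal_rpow_of_nonneg p₂.le hl'.le]
  simp only [Pi.mul_apply, ENNReal.mul_rpow_of_nonneg _ _ hl.le,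
    ENNReal.mul_rpow_of_nonneg _ _ hl'.le]
  refine le_trans (mul_le_mul_right (ENNReal.rpow_le_rpow hx hQ.le) _) (le_of_eq ?_)
  rw [ENNReal.mul_rpow_of_nonneg _ _ hQ.le, ENNReal.mul_rpow_of_nonneg _ _ hQ.le,
    ← ENNReal.rpow_mul, ← ENNReal.rpow_mul, ← ENNReal.rpow_mul, ← ENNReal.rpow_mul,
    mul_comm l Q, mul_comm (1 - l) Q]
  ring

end LaguerreConv

end

open LaguerreConv in
theorem theorem5p2 {d : ℕ} (hd : 1 ≤ d) (β γ α : Fin d → ℝ)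
    (hβ : ∀ i, -1 < β i) (hγ : ∀ i, -1 < γ i) (hβγ : β ≠ γ)
    (σ₁ σ₂ σ : ℝ) (hσ₁ : 0 < σ₁) (hσ₂ : 0 < σ₂)
    (p q : ℝ≥0∞) (hp : 1 ≤ p) (hp' : p < ∞) (hq : 1 ≤ q) (hq' : q < ∞)
    (U₁ U₂ V₁ V₂ U V : (Fin d → ℝ) → ℝ)
    (hU₁ : LaguerreConv.IsPosWeight U₁) (hU₂ : LaguerreConv.IsPosWeight U₂)
    (hV₁ : LaguerreConv.IsPosWeight V₁) (hV₂ : LaguerreConv.IsPosWeight V₂)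
    (lam : ℝ) (hlam₀ : 0 < lam) (hlam₁ : lam < 1)
    (hα : ∀ i, α i = lam * β i + (1 - lam) * γ i)
    (hσ : σ = lam * σ₁ + (1 - lam) * σ₂)
    (hU : ∀ x, U x = U₁ x ^ lam * U₂ x ^ (1 - lam))
    (hV : ∀ x, V x = V₁ x ^ lam * V₂ x ^ (1 - lam))
    (h₁ : LaguerreConv.PotentialBounded β σ₁ p q U₁ V₁)
    (h₂ : LaguerreConv.PotentialBounded γ σ₂ p q U₂ V₂) :
    LaguerreConv.PotentialBounded α σ p q U V := by
  have hl' : 0 < 1 - lam := by linarith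
  have hα' : ∀ i, -1 < α i := fun i => by rw [hα]; nlinarith [hβ i, hγ i]
  have hσ0 : 0 < σ := by rw [hσ]; positivity
  have hp0 : p ≠ 0 := (zero_lt_one.trans_le hp).ne'
  have hq0 : q ≠ 0 := (zero_lt_one.trans_le hq).ne'
  have hP : 0 < p.toReal := ENNReal.toReal_pos hp0 hp'.ne
  have hQ : 0 < q.toReal := ENNReal.toReal_pos hq0 hq'.ne
  have hUw := isPosWeight_interpolate hU₁ hU₂ hU
  have hVw := isPosWeight_interpolate hV₁ hV₂ hV
  obtain ⟨C₀, hC₀⟩ := lpotential_le hd hβ hγ hlam₀ hlam₁ hα hσ₁ hσ₂ hσ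
  obtain ⟨C₁, hC₁⟩ := h₁
  obtain ⟨C₂, hC₂⟩ := h₂
  refine ⟨C₀ * (C₁ ^ lam * C₂ ^ (1 - lam)), fun f hf => ?_⟩
  have hfm : AEStronglyMeasurable f (orthantVolume d) := hf.1.mono_ac (ac_weightedMu hUw α)
  obtain ⟨g₁, g₂, hg₁, hg₂, hg₁0, hg₂0, hg⟩ := exists_splitting hP hα hU₁ hU₂ hU hfm
  have hc₁ : AEStronglyMeasurable (fun y => (g₁ y : ℂ)) (orthantVolume d) :=
    Complex.continuous_ofReal.comp_aestronglyMeasurable hg₁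
  have hc₂ : AEStronglyMeasurable (fun y => (g₂ y : ℂ)) (orthantVolume d) :=
    Complex.continuous_ofReal.comp_aestronglyMeasurable hg₂
  have n₁ : eLpNorm (fun y => (g₁ y : ℂ)) p (weightedMu U₁ β) = eLpNorm f p (weightedMu U α) := by
    rw [eLpNorm_eq_lintegral_rpow_enorm_toReal hp0 hp'.ne,
      eLpNorm_eq_lintegral_rpow_enorm_toReal hp0 hp'.ne, lintegral_enorm_rpow_eq hP hU₁ hUw hfm hg₁
        hg₁0 (hg.mono fun y hy => hy.2.1)]
  have n₂ : eLpNorm (fun y => (g₂ y : ℂ)) p (weightedMu U₂ γ) = eLpNorm f p (weightedMu U α) := by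
    rw [eLpNorm_eq_lintegral_rpow_enorm_toReal hp0 hp'.ne,
      eLpNorm_eq_lintegral_rpow_enorm_toReal hp0 hp'.ne, lintegral_enorm_rpow_eq hP hU₂ hUw hfm hg₂
        hg₂0 (hg.mono fun y hy => hy.2.2)]
  -- Only the domain statement and the norm bound are kept for the nonnegative pieces.
  obtain ⟨D₁, -, B₁⟩ := hC₁ (fun y => (g₁ y : ℂ))
    ⟨hc₁.mono_ac (weightedMu_ac _ _), by rw [n₁]; exact hf.2⟩
  obtain ⟨D₂, -, B₂⟩ := hC₂ (fun y => (g₂ y : ℂ))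
    ⟨hc₂.mono_ac (weightedMu_ac _ _), by rw [n₂]; exact hf.2⟩
  rw [n₁] at B₁
  rw [n₂] at B₂
  have hfg : ∀ᵐ y ∂(orthantVolume d), ‖f y‖ₑ =
      ‖(g₁ y : ℂ)‖ₑ ^ lam * ‖(g₂ y : ℂ)‖ₑ ^ (1 - lam) := by
    filter_upwards [hg] with y hy
    have a₁ := hg₁0 y
    have a₂ := hg₂0 y
    rw [← ofReal_norm, ← ofReal_norm, ← ofReal_norm, Complex.norm_real, Complex.norm_real,
      Real.norm_of_nonneg a₁, Real.norm_of_nonneg a₂, hy.1, ENNReal.ofReal_mul (by positivity),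
      ENNReal.ofReal_rpow_of_nonneg a₁ hlam₀.le, ENNReal.ofReal_rpow_of_nonneg a₂ hl'.le]
  have hJ : ∀ᵐ x ∂(orthantVolume d), lpotential α σ f x ≤
      C₀ * (‖potential β σ₁ (fun y => (g₁ y : ℂ)) x‖ₑ ^ lam *
        ‖potential γ σ₂ (fun y => (g₂ y : ℂ)) x‖ₑ ^ (1 - lam)) := by
    filter_upwards [D₁, D₂, ae_mem_orthant d] with x i₁ i₂ hx
    rw [enorm_potential_eq_lpotential hβ hσ₁ hg₁ hg₁0 i₁,
      enorm_potential_eq_lpotential hγ hσ₂ hg₂ hg₂0 i₂]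
    exact hC₀ f _ _ hc₁ hc₂ hfg x hx
  -- The right side of `hJ` is finite because it is built from norms of complex numbers; this yields
  -- absolute convergence for `f`.
  have hdom : InDomain α σ f := by
    filter_upwards [hJ] with x hx
    refine ⟨(aestronglyMeasurable_kernel_mul hα' σ hfm x).mono_ac (mu_ac α), ?_⟩
    rw [HasFiniteIntegral, lintegral_kernel_mul_eq_lpotential hα' hσ0 hfm]
    refine hx.trans_lt (ENNReal.mul_lt_top ENNReal.coe_lt_top (ENNReal.mul_lt_top ?_ ?_))
    · exact ENNReal.rpow_lt_top_of_nonneg hlam₀.le enorm_ne_top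
    · exact ENNReal.rpow_lt_top_of_nonneg hl'.le enorm_ne_top
  have hpot : ∀ᵐ x ∂(orthantVolume d), ‖potential α σ f x‖ₑ ≤
      C₀ * (‖potential β σ₁ (fun y => (g₁ y : ℂ)) x‖ₑ ^ lam *
        ‖potential γ σ₂ (fun y => (g₂ y : ℂ)) x‖ₑ ^ (1 - lam)) := by
    filter_upwards [hJ] with x hx
    refine le_trans ?_ hx
    rw [← lintegral_kernel_mul_eq_lpotential hα' hσ0 hfm]
    exact enorm_integral_le_lintegral_enorm _
  have hint := lintegral_enorm_rpow_le hQ hlam₀ hlam₁ hα hV₁ hV₂ hV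
    (aestronglyMeasurable_potential hα' σ hfm _) (aestronglyMeasurable_potential hβ σ₁ hc₁ _)
    (aestronglyMeasurable_potential hγ σ₂ hc₂ _) hpot
  have hnorm : eLpNorm (potential α σ f) q (weightedMu V α) ≤
      (C₀ * (C₁ ^ lam * C₂ ^ (1 - lam)) : ℝ≥0) * eLpNorm f p (weightedMu U α) := by
    rw [eLpNorm_eq_lintegral_rpow_enorm_toReal hq0 hq'.ne] at B₁ B₂ ⊢
    have hQ' : 0 ≤ 1 / q.toReal := by positivity
    refine (ENNReal.rpow_le_rpow hint hQ').trans ?_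
    rw [ENNReal.mul_rpow_of_nonneg _ _ hQ', ENNReal.mul_rpow_of_nonneg _ _ hQ',
      ← ENNReal.rpow_mul, ← ENNReal.rpow_mul, ← ENNReal.rpow_mul, mul_one_div_cancel hQ.ne',
      ENNReal.rpow_one, mul_comm lam, mul_comm (1 - lam), ENNReal.rpow_mul, ENNReal.rpow_mul]
    -- Both bounds carry the same norm of `f`, so its powers `lam` and `1 - lam` recombine to the
    -- first power.
    calc _ ≤ (C₀ : ℝ≥0∞) * ((C₁ * eLpNorm f p (weightedMu U α)) ^ lam *
          (C₂ * eLpNorm f p (weightedMu U α)) ^ (1 - lam)) := by gcongr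
      _ = (C₀ : ℝ≥0∞) * ((C₁ : ℝ≥0∞) ^ lam * (C₂ : ℝ≥0∞) ^ (1 - lam)) *
          (eLpNorm f p (weightedMu U α) ^ lam * eLpNorm f p (weightedMu U α) ^ (1 - lam)) := by
          rw [ENNReal.mul_rpow_of_nonneg _ _ hlam₀.le, ENNReal.mul_rpow_of_nonneg _ _ hl'.le]
          ring
      _ = _ := by
          rw [← ENNReal.rpow_add_of_nonneg _ _ hlam₀.le hl'.le, add_sub_cancel, ENNReal.rpow_one,
            ENNReal.coe_mul, ENNReal.coe_mul, ENNReal.coe_rpow_of_nonneg _ hlam₀.le,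
            ENNReal.coe_rpow_of_nonneg _ hl'.le]
  exact ⟨hdom, ⟨aestronglyMeasurable_potential hα' σ hfm _,
    hnorm.trans_lt (ENNReal.mul_lt_top ENNReal.coe_lt_top hf.2)⟩, hnorm⟩
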